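/- **Setting.** Let $h,g:\mathbb R^n\to\mathbb R$ be differentiable and $f=h+g$. Assume: 1. $f$ has an $L_f$-Lipschitz gradient and is $\mu$-strongly convex with $\mu\ge 0$ (convex if $\mu=0$). It has a minimizer $x^*$. 2. $h$ has an $L_h$-Lipschitz gradient, and an oracle $O_h$ returns $\nabla h(x)$ in one call. 3. $g$ has an $L_g$-Lipschitz gradient, and there is a basic oracle $O_g$ from which $\nabla g(x)$ is obtained in at most $\kappa_g$ calls. 4. Let $0<L\le L_h$, $\alpha=L+L_h$ and $\tau_g>\sqrt\alpha$. There is a randomized method $\mathcal M_{inn}$ for the problems $\min_v\varphi(v)$ with $\varphi(v)=\langle\beta,v\rangle+\frac\alpha2\|v\|^2+g(v)$. Run with budget $N$ from $v^0$, it makes at most $N$ calls to $O_g$. For every $\tilde\varepsilon>0$ its output $\hat v$ satisfies $\mathbb E[\varphi(\hat v)-\varphi(v^*)]\le\tilde\varepsilon$ as soon as $N\ge c\,\frac{\tau_g}{\sqrt\alpha}\ln\frac{C\|v^0-v^*\|^2}{\tilde\varepsilon}$, where $v^*$ minimizes $\varphi$ and $c,C>0$ are constants. **The framework.** Write $F_x(\zeta)=f(\zeta)+\frac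 L2\|\zeta-x\|^2$. * *Middle loop* $\mathrm{GMCO}(x)$. Start at $\zeta^0=x$. For $k=1,2,\dots$ let $\zeta^k$ be the output of $\mathcal M_{inn}$ with budget $N_{inn}$, started at $\zeta^{k-1}$ with fresh independent randomness, on $$\langle\nabla h(\zeta^{k-1}),\zeta-\zeta^{k-1}\rangle+g(\zeta)+\tfrac L2\|\zeta-\zeta^0\|^2+\tfrac{L_h}2\|\zeta-\zeta^{k-1}\|^2 .$$ Stop and return $\zeta^k$ as soon as $\|\nabla F_x(\zeta^k)\|\le\frac L2\|\zeta^k-\zeta^0\|$. * *Outer loop* $\mathrm{MS}(x^0,N)$ (Monteiro–Svaiter). Start with $y^0=z^0=x^0$ and $A_0=0$. For $k=0,\dots,N-1$ put $a_{k+1}=\frac12\bigl(\frac1L+\sqrt{\frac1{L^2}+\frac{4A_k}L}\bigr)$, $A_{k+1}=A_k+a_{k+1}$, $x^{k+1}=\frac{A_k}{A_{k+1}}y^k+\frac{a_{k+1}}{A_{k+1}}z^k$, $y^{k+1}=\mathrm{GMCO}(x^{k+1})$ and $z^{k+1}=z^k-a_{k+1}\nabla f(y^{k+1})$. Return $y^N$.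 * If $\mu=0$, run $\mathrm{MS}(x^0,\lceil\sqrt{2LR^2/\varepsilon}\,\rceil)$. If $\mu>0$, run $\mathrm{MS}(\cdot,\lceil\sqrt{8L/\mu}\,\rceil)$ successively $\lceil\log_2(\mu R^2/\varepsilon)\rceil$ times, each time from the previous output, starting at $x^0$. **Theorem 1.** There are a constant $K_h>0$ (absolute), constants $K_{inn},K_g>0$ depending only on $c$, and a constant $C_1>0$ depending only on $c,C,L_f,L_g,L_h,L$, such that the following holds for all $n,h,g,\mu,\kappa_g,\tau_g,O_g,\mathcal M_{inn}$ as above, all $x^0$, all $R\ge\|x^0-x^*\|$, all $\varepsilon>0$ and all $\delta\in(0,1)$. a) Let $\mu=0$ and $\varepsilon\le LR^2$. With $N_{inn}=\Bigl\lceil K_{inn}\frac{\tau_g}{\sqrt{L+L_h}}\ln\frac{C_1R}{\delta\sqrt\varepsilon}\Bigr\rceil$, with probability at least $1-\delta$ the framework terminates with a point $\hat x$ such that $f(\hat x)-f(x^*)\le\varepsilon$, after at most $$K_h\sqrt{\tfrac{LR^2}{\varepsilon}}\Bigl(1+\tfrac{L_h}{L}\Bigr)\ \text{ calls to } O_h\quad\text{and}\quad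 K_g\sqrt{\tfrac{LR^2}{\varepsilon}}\Bigl(\kappa_g+\tfrac{L_h}{L}\,\tfrac{\tau_g}{\sqrt{L+L_h}}\ln\tfrac{C_1R}{\delta\sqrt\varepsilon}\Bigr)\ \text{ calls to } O_g .$$ b) Let $0<\mu\le L$ and $\varepsilon\le\mu R^2/2$. With $N_{inn}=\Bigl\lceil K_{inn}\frac{\tau_g}{\sqrt{L+L_h}}\ln\frac{C_1}{\delta}\Bigr\rceil$, with probability at least $1-\delta$ the framework terminates with a point $\hat x$ such that $f(\hat x)-f(x^*)\le\varepsilon$, after at most $$K_h\sqrt{\tfrac L\mu}\,\ln\tfrac{\mu R^2}\varepsilon\Bigl(1+\tfrac{L_h}{L}\Bigr)\ \text{ calls to } O_h\quad\text{and}\quad K_g\sqrt{\tfrac L\mu}\,\ln\tfrac{\mu R^2}\varepsilon\Bigl(\kappa_g+\tfrac{L_h}{L}\,\tfrac{\tau_g}{\sqrt{L+L_h}}\ln\tfrac{C_1}{\delta}\Bigr)\ \text{ calls to } O_g .$$ Here the $O_g$-calls are those of $\mathcal M_{inn}$ and of the gradients in the outer loop. If the $O_g$-calls for evaluating the stopping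 test of the middle loop are counted too, then, on the same event, the bounds hold with $\kappa_g$ replaced by $\kappa_g(1+L_h/L)$, which is of the same order for bounded $L_h/L$. The $O_h$-calls include those of the stopping tests. -/

import Mathlib

open MeasureTheory

namespace OracleSeparation

/-- Euclidean space `ℝⁿ`. -/
abbrev Vec (n : ℕ) := EuclideanSpace ℝ (Fin n)

/-- `f` is `L`-smooth: differentiable with an `L`-Lipschitz gradient. -/
def IsSmooth {n : ℕ} (f : Vec n → ℝ) (L : ℝ) : Prop :=
  Differentiable ℝ f ∧ ∀ x y, ‖gradient f x - gradient f y‖ ≤ L * ‖x - y‖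

/-- A computation that may adaptively query an oracle with query type `Q` and answer type `A`
before it returns an element of `X`. -/
inductive OracleProg (Q : Type*) (A : Type*) (X : Type*)
  | ret (x : X) : OracleProg Q A X
  | ask (q : Q) (cont : A → OracleProg Q A X) : OracleProg Q A X

/-- The value returned when every query `q` is answered by `O q`. -/
def OracleProg.output {Q A X : Type*} (O : Q → A) : OracleProg Q A X → X
  | .ret x => x
  | .ask q cont => (cont (O q)).output O

/-- The number of oracle calls made when every query `q` is answered by `O q`. -/
def OracleProg.calls {Q A X : Type*} (O : Q → A) : OracleProg Q A X → ℕ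
  | .ret _ => 0
  | .ask q cont => (cont (O q)).calls O + 1

/-- A basic oracle for `g`, from which the full gradient of `g` at any point is
obtained in at most `κ` calls. -/
structure BasicOracle {n : ℕ} (g : Vec n → ℝ) (κ : ℕ) (Q A : Type*) where
  answer : Q → A
  grad : Vec n → OracleProg Q A (Vec n)
  grad_output : ∀ x, (grad x).output answer = gradient g x
  grad_calls : ∀ x, (grad x).calls answer ≤ κ

/-- The objective `⟨β, v⟩ + (α / 2) ‖v‖² + g v` of the inner problems. -/
noncomputable def innerObj {n : ℕ} (g : Vec n → ℝ) (α : ℝ) (β v : Vec n) : ℝ :=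
  inner ℝ β v + α / 2 * ‖v‖ ^ 2 + g v

/-- A randomized method for the problems `min_v ⟨β, v⟩ + (α / 2) ‖v‖² + g v`. Run on `β` from the
starting point `v⁰` with budget `N` and a random seed of law `ν`, it makes at most `N` calls to
the basic oracle, and its output has expected residual at most `ε'` as soon as
`N ≥ c (τ / √α) ln (C ‖v⁰ - v⋆‖² / ε')`, for a minimizer `v⋆`. -/
structure InnerMethod {n : ℕ} (g : Vec n → ℝ) {Q A S : Type*} [MeasurableSpace S]
    (answer : Q → A) (ν : Measure S) (α c C τ : ℝ) where
  prog : Vec n → Vec n → ℕ → S → OracleProg Q A (Vec n)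
  calls_le : ∀ β v₀ N s, (prog β v₀ N s).calls answer ≤ N
  measurable_output : ∀ N, Measurable fun p : Vec n × Vec n × S =>
    (prog p.1 p.2.1 N p.2.2).output answer
  rate : ∀ (β v₀ vmin : Vec n) (ε' : ℝ) (N : ℕ), 0 < ε' →
    (∀ v, innerObj g α β vmin ≤ innerObj g α β v) →
    c * (τ / Real.sqrt α) * Real.log (C * ‖v₀ - vmin‖ ^ 2 / ε') ≤ N →
    Integrable (fun s => innerObj g α β ((prog β v₀ N s).output answer)
      - innerObj g α β vmin) ν ∧
    ∫ s, (innerObj g α β ((prog β v₀ N s).output answer) - innerObj g α β vmin) ∂ν ≤ ε'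

/-- A point computed so far, with the numbers of oracle calls spent on it: `callsH` calls to the
gradient oracle of `h`, `callsG` calls to the basic oracle of `g` made by the inner method and by
the gradient steps of the outer loop, `testsG` calls to the basic oracle of `g` made to evaluate
the stopping tests of the middle loop. -/
structure Run (n : ℕ) where
  point : Vec n
  callsH : ℕ
  callsG : ℕ
  testsG : ℕ

section Algorithms

variable {n : ℕ} {g : Vec n → ℝ} {κ : ℕ} {Q A S : Type*} [MeasurableSpace S] {ν : Measure S}
  {c C τ L Lh : ℝ}

/-- The first `k` iterations of the composite gradient method for
`F ζ = h ζ + g ζ + (L / 2) ‖ζ - ζ₀‖²` from `ζ₀`. One iteration applies the inner method with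
budget `N`, warm-started at the current `ζ`, to
`⟨∇h ζ, v - ζ⟩ + g v + (L / 2) ‖v - ζ₀‖² + (Lh / 2) ‖v - ζ‖²`, which up to an additive constant is
`innerObj g (L + Lh) (∇h ζ - L ζ₀ - Lh ζ) v`. Its cost is one call for `∇h` at the old point, the
calls of the inner method, and the gradients of `h` and of `g` at the new point, which the
stopping test needs. -/
noncomputable def gmcoIter (h : Vec n → ℝ) (O : BasicOracle g κ Q A)
    (M : InnerMethod g O.answer ν (L + Lh) c C τ) (N : ℕ) (ζ₀ : Vec n) (s : ℕ → S) : ℕ → Run n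
  | 0 => ⟨ζ₀, 0, 0, 0⟩
  | k + 1 =>
    let r := gmcoIter h O M N ζ₀ s k
    let p := M.prog (gradient h r.point - L • ζ₀ - Lh • r.point) r.point N (s k)
    let ζ := p.output O.answer
    ⟨ζ, r.callsH + 2, r.callsG + p.calls O.answer, r.testsG + (O.grad ζ).calls O.answer⟩

/-- The stopping test `‖∇F ζ‖ ≤ (L / 2) ‖ζ - ζ₀‖`, `F ζ = h ζ + g ζ + (L / 2) ‖ζ - ζ₀‖²`. -/
def gmcoStop (h : Vec n → ℝ) (O : BasicOracle g κ Q A) (L : ℝ) (ζ₀ ζ : Vec n) : Prop :=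
  ‖gradient h ζ + (O.grad ζ).output O.answer + L • (ζ - ζ₀)‖ ≤ L / 2 * ‖ζ - ζ₀‖

open Classical in
/-- The composite gradient method: iterate (at least once) until the stopping test holds;
`none` if this never happens. -/
noncomputable def gmco (h : Vec n → ℝ) (O : BasicOracle g κ Q A)
    (M : InnerMethod g O.answer ν (L + Lh) c C τ) (N : ℕ) (ζ₀ : Vec n) (s : ℕ → S) :
    Option (Run n) :=
  if H : ∃ k, 1 ≤ k ∧ gmcoStop h O L ζ₀ (gmcoIter h O M N ζ₀ s k).point then
    some (gmcoIter h O M N ζ₀ s (Nat.find H))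
  else none

/-- State of the Monteiro-Svaiter loop: the point `y` with its cost, and `z`, `A`. -/
structure MSState (n : ℕ) where
  y : Run n
  z : Vec n
  A : ℝ

/-- The first `k` iterations of the Monteiro-Svaiter method from `x₀`; `s k` is the stream of
seeds of the `k`-th call of the middle loop. -/
noncomputable def msIter (h : Vec n → ℝ) (O : BasicOracle g κ Q A)
    (M : InnerMethod g O.answer ν (L + Lh) c C τ) (N : ℕ) (x₀ : Vec n) (s : ℕ → ℕ → S) :
    ℕ → Option (MSState n)
  | 0 => some ⟨⟨x₀, 0, 0, 0⟩, x₀, 0⟩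
  | k + 1 => (msIter h O M N x₀ s k).bind fun σ =>
    let a := (1 / L + Real.sqrt (1 / L ^ 2 + 4 * σ.A / L)) / 2
    let A' := σ.A + a
    let x := (σ.A / A') • σ.y.point + (a / A') • σ.z
    (gmco h O M N x (s k)).map fun r =>
      { y := ⟨r.point, σ.y.callsH + r.callsH + 1,
          σ.y.callsG + r.callsG + (O.grad r.point).calls O.answer, σ.y.testsG + r.testsG⟩
        z := σ.z - a • (gradient h r.point + (O.grad r.point).output O.answer)
        A := A' }

/-- `m` iterations of the Monteiro-Svaiter method from `x₀`; the output is `y^m`. -/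
noncomputable def ms (h : Vec n → ℝ) (O : BasicOracle g κ Q A)
    (M : InnerMethod g O.answer ν (L + Lh) c C τ) (N : ℕ) (x₀ : Vec n) (s : ℕ → ℕ → S) (m : ℕ) :
    Option (Run n) :=
  (msIter h O M N x₀ s m).map fun σ => σ.y

/-- `T` restarts of the Monteiro-Svaiter method, with `m` iterations each. -/
noncomputable def msRestart (h : Vec n → ℝ) (O : BasicOracle g κ Q A)
    (M : InnerMethod g O.answer ν (L + Lh) c C τ) (N : ℕ) (x₀ : Vec n) (s : ℕ → ℕ → ℕ → S)
    (m : ℕ) : ℕ → Option (Run n)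
  | 0 => some ⟨x₀, 0, 0, 0⟩
  | t + 1 => (msRestart h O M N x₀ s m t).bind fun σ =>
    (ms h O M N σ.point (s t) m).map fun r =>
      ⟨r.point, σ.callsH + r.callsH, σ.callsG + r.callsG, σ.testsG + r.testsG⟩

/-- The three-loop framework with inner budget `N`, on the seeds `ω`. For `μ = 0` it runs
`⌈√(2 L R² / ε)⌉` iterations of the Monteiro-Svaiter method; otherwise it runs
`⌈log₂ (μ R² / ε)⌉` restarts with `⌈√(8 L / μ)⌉` iterations each. -/
noncomputable def framework (h : Vec n → ℝ) (O : BasicOracle g κ Q A)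
    (M : InnerMethod g O.answer ν (L + Lh) c C τ) (N : ℕ) (μ R ε : ℝ) (x₀ : Vec n)
    (ω : ℕ × ℕ × ℕ → S) : Option (Run n) :=
  if μ = 0 then
    ms h O M N x₀ (fun k j => ω (0, k, j)) ⌈Real.sqrt (2 * L * R ^ 2 / ε)⌉₊
  else
    msRestart h O M N x₀ (fun t k j => ω (t, k, j)) ⌈Real.sqrt (8 * L / μ)⌉₊
      ⌈Real.logb 2 (μ * R ^ 2 / ε)⌉₊

end Algorithms

/-- The run returns a point `x̂` with `f x̂ - f xmin ≤ ε` within the given numbers of calls: `bH` to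
the oracle of `h`, and to the basic oracle of `g`, `bG` without the stopping tests of the middle
loop and `bGall` with them. -/
def Succeeds {n : ℕ} (f : Vec n → ℝ) (xmin : Vec n) (ε bH bG bGall : ℝ) (out : Option (Run n)) :
    Prop :=
  ∃ r, out = some r ∧ f r.point - f xmin ≤ ε ∧ (r.callsH : ℝ) ≤ bH ∧ (r.callsG : ℝ) ≤ bG ∧
    (r.callsG : ℝ) + r.testsG ≤ bGall

end OracleSeparation

/-! Since `h` is `Lh`-smooth, w = (Lh/2)‖·‖² - h is convex and 2Lh-smooth, and up to a constant the
inner problem at ζ is F_x plus the Bregman divergence of w from ζ. The middle loop is thus an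
inexact Bregman proximal method for the L-strongly convex F_x. Once every middle loop stops, the
outer loop is deterministic: the stopping test makes A_k (f(y^k) - f(x*)) + ‖z^k - x*‖²/2
nonincreasing (`ms_potential_step`), and A_k ≥ k²/(4L). Under strong convexity each restart halves
the bound on the squared distance to x*. Only the number of middle iterations is random.

If 2k consecutive steps are accurate, with k ≥ 12 Lh/L, one of them passes the test
(`exists_small_grad`): up to small errors, k steps reduce the gap to O(Lh D²/k), D being the
distance from the start to the minimizer, and k more produce a gradient of norm at most L D/3.
Linear contraction alone would cost an extra logarithm. With relative inner accuracy q, Markov's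
inequality shows that some step is inaccurate with probability O(q). Even then the expected gap
contracts, so the stopping time has a geometric tail. Combining both bounds through their geometric
mean, the expected number of iterations beyond 2k is O(√q), hence at most δ once q ≤ q₁δ²
(`exists_accuracy`). Such a q costs a budget logarithmic in 1/δ.

Finally Markov's inequality is applied once, to the sum of the excesses over all J middle loops: its
mean is at most Jδ, so it is below J with probability at least 1 - δ (`measure_total_excess_lt`). No
union bound over the J loops is taken, so the inner budget does not depend on J. -/

namespace OracleSeparation

/-! ### Bregman divergences and inexact Bregman proximal steps -/

section Bregman

variable {E : Type*} [NormedAddCommGroup E] [InnerProductSpace ℝ E]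

/-- The Bregman divergence of `p` with gradient `dp`. -/
def breg (p : E → ℝ) (dp : E → E) (y x : E) : ℝ := p y - p x - inner ℝ (dp x) (y - x)

/-- Two-sided quadratic bounds on the Bregman divergence of `p`. -/
def BregBounds (p : E → ℝ) (dp : E → E) (m M : ℝ) : Prop :=
  ∀ x y, m / 2 * ‖y - x‖ ^ 2 ≤ breg p dp y x ∧ breg p dp y x ≤ M / 2 * ‖y - x‖ ^ 2

lemma breg_self (p : E → ℝ) (dp : E → E) (x : E) : breg p dp x x = 0 := by simp [breg]

lemma breg_add (p q : E → ℝ) (dp dq : E → E) (y x : E) :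
    breg (fun v => p v + q v) (fun v => dp v + dq v) y x = breg p dp y x + breg q dq y x := by
  simp only [breg, inner_add_left]; ring

lemma breg_sq (a : ℝ) (c y x : E) :
    breg (fun v => a / 2 * ‖v - c‖ ^ 2) (fun v => a • (v - c)) y x = a / 2 * ‖y - x‖ ^ 2 := by
  have h : y - c = (y - x) + (x - c) := by abel
  simp only [breg]
  rw [h, norm_add_sq_real, inner_smul_left, real_inner_comm]
  simp only [conj_trivial]
  ring

/-- The divergence from a fixed `z` differs from `w` by an affine function, which divergences do not
see. -/
lemma breg_breg (w : E → ℝ) (dw : E → E) (z y x : E) :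
    breg (fun v => breg w dw v z) (fun v => dw v - dw z) y x = breg w dw y x := by
  have h : y - x = (y - z) - (x - z) := by abel
  simp only [breg, inner_sub_left]
  rw [h]
  simp only [inner_sub_right]
  ring

lemma breg_three_point (w : E → ℝ) (dw : E → E) (u y x : E) :
    inner ℝ (dw x - dw y) (u - y) = breg w dw u y + breg w dw y x - breg w dw u x := by
  simp only [breg, inner_sub_left, inner_sub_right]
  ring

lemma BregBounds.add {p q : E → ℝ} {dp dq : E → E} {a b c d : ℝ} (hp : BregBounds p dp a b)
    (hq : BregBounds q dq c d) :
    BregBounds (fun v => p v + q v) (fun v => dp v + dq v) (a + c) (b + d) := by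
  intro x y
  rw [breg_add]
  have h1 := hp x y
  have h2 := hq x y
  constructor <;> nlinarith

lemma BregBounds.sq (a : ℝ) (c : E) :
    BregBounds (fun v => a / 2 * ‖v - c‖ ^ 2) (fun v => a • (v - c)) a a := fun x y => by
  rw [breg_sq]; exact ⟨le_rfl, le_rfl⟩

lemma BregBounds.divergence {w : E → ℝ} {dw : E → E} {a b : ℝ} (hw : BregBounds w dw a b) (z : E) :
    BregBounds (fun v => breg w dw v z) (fun v => dw v - dw z) a b := fun x y => by
  rw [breg_breg]; exact hw x y

/-- Compare the minimal value with the value after a gradient step of length 1/M from `x`. -/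
lemma BregBounds.norm_grad_sq_le {p : E → ℝ} {dp : E → E} {m M : ℝ} (hp : BregBounds p dp m M)
    (hM : 0 < M) {v : E} (hv : ∀ t, p v ≤ p t) (x : E) :
    ‖dp x‖ ^ 2 ≤ 2 * M * (p x - p v) := by
  have h1 := (hp x (x - M⁻¹ • dp x)).2
  have h2 := hv (x - M⁻¹ • dp x)
  have h3 : x - M⁻¹ • dp x - x = -(M⁻¹ • dp x) := by abel
  rw [breg, h3, norm_neg, norm_smul, inner_neg_right, inner_smul_right,
    real_inner_self_eq_norm_sq, Real.norm_of_nonneg (inv_nonneg.2 hM.le)] at h1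
  have h4 : M / 2 * (M⁻¹ * ‖dp x‖) ^ 2 = M⁻¹ * ‖dp x‖ ^ 2 / 2 := by field_simp
  rw [h4] at h1
  have h5 : M⁻¹ * ‖dp x‖ ^ 2 ≤ 2 * (p x - p v) := by linarith
  calc ‖dp x‖ ^ 2 = M * (M⁻¹ * ‖dp x‖ ^ 2) := by field_simp
    _ ≤ M * (2 * (p x - p v)) := by gcongr
    _ = _ := by ring

lemma BregBounds.grad_eq_zero {p : E → ℝ} {dp : E → E} {m M : ℝ} (hp : BregBounds p dp m M)
    (hM : 0 < M) {v : E} (hv : ∀ t, p v ≤ p t) : dp v = 0 := by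
  have h := hp.norm_grad_sq_le hM hv v
  rw [sub_self, mul_zero] at h
  have : ‖dp v‖ = 0 := by nlinarith [norm_nonneg (dp v)]
  simpa using this

lemma BregBounds.dist_sq_le {p : E → ℝ} {dp : E → E} {m M : ℝ} (hp : BregBounds p dp m M)
    (hM : 0 < M) {v : E} (hv : ∀ t, p v ≤ p t) (x : E) :
    m / 2 * ‖x - v‖ ^ 2 ≤ p x - p v ∧ p x - p v ≤ M / 2 * ‖x - v‖ ^ 2 := by
  have h := hp v x
  simpa [breg, hp.grad_eq_zero hM hv] using h

/-- Adding quadratic growth at `v` to the lower divergence bound at `x` gives m‖x - v‖² ≤ ⟨dp x, x -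
v⟩; then Cauchy–Schwarz. -/
lemma BregBounds.dist_le {p : E → ℝ} {dp : E → E} {m M : ℝ} (hp : BregBounds p dp m M)
    (hM : 0 < M) {v : E} (hv : ∀ t, p v ≤ p t) (x : E) : m * ‖x - v‖ ≤ ‖dp x‖ := by
  have h1 := (hp.dist_sq_le hM hv x).1
  have h2 := (hp x v).1
  rw [breg, norm_sub_rev] at h2
  have h3 : -inner ℝ (dp x) (v - x) ≤ ‖dp x‖ * ‖x - v‖ := by
    rw [← inner_neg_right, neg_sub]; exact real_inner_le_norm _ _
  rcases (norm_nonneg (x - v)).eq_or_lt with h0 | h0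
  · rw [← h0]; simp
  · have h4 : (m * ‖x - v‖) * ‖x - v‖ ≤ ‖dp x‖ * ‖x - v‖ := by nlinarith
    exact le_of_mul_le_mul_right h4 h0

/-- The divergence of `w` from `x` is minimal at `x` with value 0, so `norm_grad_sq_le` applies to
it. -/
lemma BregBounds.cocoercive {w : E → ℝ} {dw : E → E} {M : ℝ} (hw : BregBounds w dw 0 M)
    (hM : 0 < M) (y x : E) : ‖dw y - dw x‖ ^ 2 ≤ 2 * M * breg w dw y x := by
  have h := (hw.divergence x).norm_grad_sq_le hM (v := x) (fun t => by
    rw [breg_self]; simpa using (hw x t).1) y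
  simpa [breg_self] using h

/-- The surrogate of `F` at `z` with the Bregman divergence of `w` added. -/
def surr (F w : E → ℝ) (dw : E → E) (z v : E) : ℝ := F v + breg w dw v z

/-- The gradient of the surrogate. -/
def surrGrad (dF dw : E → E) (z v : E) : E := dF v + (dw v - dw z)

variable {F w : E → ℝ} {dF dw : E → E} {L MF Mw : ℝ}

lemma surr_bounds (hF : BregBounds F dF L MF) (hw : BregBounds w dw 0 Mw) (z : E) :
    BregBounds (surr F w dw z) (surrGrad dF dw z) L (MF + Mw) := by
  have := hF.add (hw.divergence z)
  rwa [add_zero] at this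

lemma surr_self (z : E) : surr F w dw z z = F z := by simp [surr, breg_self]

lemma le_surr (hw : BregBounds w dw 0 Mw) (z v : E) : F v ≤ surr F w dw z v := by
  have := (hw z v).1
  simp only [surr]; linarith

/-- Test the minimum on the segment from `z` to `u`, at the fraction l for which the strong
convexity of `F` exactly pays for the divergence of `w`: L(1 - l) = Mw l. -/
lemma surr_min_le (hF : BregBounds F dF L MF) (hw : BregBounds w dw 0 Mw) (hL : 0 < L)
    (hMw : 0 < Mw) {z v : E} (u : E) (hv : ∀ t, surr F w dw z v ≤ surr F w dw z t) :
    surr F w dw z v - F u ≤ (1 - L / (L + Mw)) * (F z - F u) := by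
  set l := L / (L + Mw) with hl
  have hl0 : 0 ≤ l := by positivity
  have hl1 : l ≤ 1 := by rw [hl, div_le_one (by positivity)]; linarith
  have hkey : L * (1 - l) = Mw * l := by rw [hl]; field_simp; ring
  set d := u - z with hd
  set t := z + l • d with ht
  have h1 := (hF t z).1
  have h2 := (hF t u).1
  have h3 := (hw z t).2
  have h4 := hv t
  have e1 : z - t = -(l • d) := by rw [ht]; abel
  have e2 : u - t = (1 - l) • d := by rw [ht, sub_smul, one_smul, hd]; abel
  have e3 : t - z = l • d := by rw [ht]; abel
  rw [breg, e1, inner_neg_right, inner_smul_right, norm_neg, norm_smul,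
    Real.norm_of_nonneg hl0] at h1
  rw [breg, e2, inner_smul_right, norm_smul, Real.norm_of_nonneg (by linarith)] at h2
  rw [e3, norm_smul, Real.norm_of_nonneg hl0] at h3
  simp only [surr] at h4 ⊢
  have h1' := mul_le_mul_of_nonneg_left h1 (by linarith : 0 ≤ 1 - l)
  have h2' := mul_le_mul_of_nonneg_left h2 hl0
  have e4 : L / 2 * (1 - l) * l * ‖d‖ ^ 2 = Mw / 2 * (l * ‖d‖) ^ 2 := by
    linear_combination (l * ‖d‖ ^ 2 / 2) * hkey
  nlinarith

/-- Converts the inner method's guarantee, stated through the distance from the warm start, into an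
error relative to the current gap of `F`. -/
lemma surr_dist_sq_le (hF : BregBounds F dF L MF) (hw : BregBounds w dw 0 Mw) (hMF : 0 < MF)
    (hMw : 0 < Mw) {z v u : E} (hu : ∀ t, F u ≤ F t)
    (hv : ∀ t, surr F w dw z v ≤ surr F w dw z t) :
    L / 2 * ‖z - v‖ ^ 2 ≤ F z - F u := by
  have h1 := ((surr_bounds hF hw z).dist_sq_le (by linarith) hv z).1
  rw [surr_self] at h1
  have h2 := le_surr (F := F) hw z v
  linarith [hu v]

/-- Three-point identity for `w`; the term L/2 ‖u - z'‖² from strong convexity absorbs the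
inexactness of the step by Young's inequality. -/
lemma surr_step (hF : BregBounds F dF L MF) (hL : 0 < L) (u z z' : E) :
    F z' - F u + breg w dw u z' + breg w dw z' z ≤
      breg w dw u z + ‖surrGrad dF dw z z'‖ ^ 2 / (2 * L) := by
  have h1 := (hF z' u).1
  have h2 := breg_three_point w dw u z' z
  have h3 : dF z' = surrGrad dF dw z z' + (dw z - dw z') := by simp only [surrGrad]; abel
  rw [breg, h3, inner_add_left, h2] at h1
  have h4 : -inner ℝ (surrGrad dF dw z z') (u - z') ≤ ‖surrGrad dF dw z z'‖ * ‖u - z'‖ := by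
    rw [← inner_neg_left, ← norm_neg (surrGrad dF dw z z')]
    exact real_inner_le_norm _ _
  have h5 : ‖surrGrad dF dw z z'‖ * ‖u - z'‖ ≤
      ‖surrGrad dF dw z z'‖ ^ 2 / (2 * L) + L / 2 * ‖u - z'‖ ^ 2 := by
    have : ‖surrGrad dF dw z z'‖ ^ 2 / (2 * L) + L / 2 * ‖u - z'‖ ^ 2 -
        ‖surrGrad dF dw z z'‖ * ‖u - z'‖ =
        (‖surrGrad dF dw z z'‖ - L * ‖u - z'‖) ^ 2 / (2 * L) := by field_simp; ring
    have : 0 ≤ (‖surrGrad dF dw z z'‖ - L * ‖u - z'‖) ^ 2 / (2 * L) := by positivity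
    linarith
  linarith

/-- The step from `z` to `z'` is as accurate as minimizing the surrogate up to `θ (F z - F u)`. -/
structure AccurateStep (F w : E → ℝ) (dF dw : E → E) (M θ : ℝ) (u z z' : E) : Prop where
  grad : ‖surrGrad dF dw z z'‖ ^ 2 ≤ 2 * M * (θ * (F z - F u))
  decrease : surr F w dw z z' ≤ F z + θ * (F z - F u)
  mono : F z' ≤ F z

/-- An exact step shrinks the gap by the fraction L / (L + Mw), so an error of at most that fraction
cannot increase `F`. -/
lemma accurateStep_of_residual (hF : BregBounds F dF L MF) (hw : BregBounds w dw 0 Mw) (hL : 0 < L)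
    (hMF : 0 < MF) (hMw : 0 < Mw) {z v u z' : E} {θ : ℝ} (hθ : θ ≤ L / (L + Mw))
    (hu : ∀ t, F u ≤ F t)
    (hv : ∀ t, surr F w dw z v ≤ surr F w dw z t)
    (he : surr F w dw z z' - surr F w dw z v ≤ θ * (F z - F u)) :
    AccurateStep F w dF dw (MF + Mw) θ u z z' where
  grad := ((surr_bounds hF hw z).norm_grad_sq_le (by linarith) hv z').trans (by gcongr)
  decrease := by
    have := hv z
    rw [surr_self] at this
    linarith
  mono := by
    have h1 := surr_min_le hF hw hL hMw u hv
    have h2 := le_surr (F := F) hw z z'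
    nlinarith [hu z]

/-- The numerical contradiction closing `exists_small_grad`: `D` is the initial distance to the
minimizer, `Δ₀` and `Δ` are the gaps at steps 0 and `k`. -/
lemma stopping_arith {L MF Mw θ k D Δ₀ Δ : ℝ} (hL : 0 < L) (hMF : 0 < MF) (hMw : 0 < Mw)
    (hθ0 : 0 ≤ θ) (hθ : θ * (MF * (4 * (MF + Mw) * (1 + Mw / L) + 4 * Mw)) ≤ L ^ 2 / 18)
    (hk1 : 1 ≤ k) (hk : 6 * Mw ≤ k * L) (hD : 0 < D) (hΔ₀ : 0 ≤ Δ₀) (hinit : Δ₀ ≤ MF / 2 * D ^ 2)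
    (hA : k * Δ ≤ Mw / 2 * D ^ 2 + k * (2 * (MF + Mw) * (θ * Δ₀) / (2 * L)))
    (hC : k * (L ^ 2 * D ^ 2 / 9) ≤
      k * (2 * (2 * (MF + Mw) * (θ * Δ₀))) + 4 * Mw * (Δ + k * (θ * Δ₀))) : False := by
  set P := 2 * (MF + Mw) * (θ * Δ₀) with hP
  have hθΔ : θ * Δ₀ * (4 * (MF + Mw) * (1 + Mw / L) + 4 * Mw) ≤ L ^ 2 / 36 * D ^ 2 := by
    have hpos : 0 ≤ θ * (4 * (MF + Mw) * (1 + Mw / L) + 4 * Mw) := by positivity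
    linarith [mul_le_mul_of_nonneg_left hinit hpos, mul_le_mul_of_nonneg_right hθ (sq_nonneg D)]
  have hP0 : 0 ≤ P := by positivity
  have hk2 : k * (4 * Mw * Δ) ≤ 2 * Mw ^ 2 * D ^ 2 + k * (2 * Mw * (P / L)) := by
    have h1 := mul_le_mul_of_nonneg_left hA (by linarith : 0 ≤ 4 * Mw)
    have h2 : 4 * Mw * (Mw / 2 * D ^ 2 + k * (P / (2 * L))) =
      2 * Mw ^ 2 * D ^ 2 + k * (2 * Mw * (P / L)) := by field_simp; ring
    linarith
  have hPe : 2 * P + 2 * Mw * (P / L) + 4 * Mw * (θ * Δ₀) =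
      θ * Δ₀ * (4 * (MF + Mw) * (1 + Mw / L) + 4 * Mw) := by
    rw [hP]; field_simp
    ring
  have hPL : 0 ≤ 2 * Mw * (P / L) := by positivity
  have hfin : k * k * (L ^ 2 * D ^ 2 / 9) ≤
      k * k * (L ^ 2 / 36 * D ^ 2) + 2 * Mw ^ 2 * D ^ 2 := by
    have h1 := mul_le_mul_of_nonneg_left hC (by linarith : 0 ≤ k)
    have h2 : k * (2 * Mw * (P / L)) ≤ k * k * (2 * Mw * (P / L)) := by
      apply mul_le_mul_of_nonneg_right _ hPL; nlinarith
    have h3 := mul_le_mul_of_nonneg_left hθΔ (by positivity : (0 : ℝ) ≤ k * k)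
    rw [← hPe] at h3
    linarith
  -- So 2 Mw² ≤ k²L²/18, and 1/36 + 1/18 < 1/9 contradicts `hfin`.
  have hMk : (6 * Mw) ^ 2 ≤ (k * L) ^ 2 := by gcongr
  have hpos : 0 < D ^ 2 * (k * k * L ^ 2) := by positivity
  linarith [mul_le_mul_of_nonneg_right hMk (sq_nonneg D)]

/-- The first `k` steps make the gap small by telescoping divergences to `u`. In the last `k` steps
the divergences between consecutive iterates sum to about that gap, and cocoercivity of `w` turns
them into gradient norms. If all gradients were large, averaging would contradict the size of `k`.
-/
lemma exists_small_grad (hF : BregBounds F dF L MF) (hw : BregBounds w dw 0 Mw) (hL : 0 < L)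
    (hMF : 0 < MF) (hMw : 0 < Mw) {u : E} (hu : ∀ t, F u ≤ F t) {θ : ℝ} (hθ0 : 0 ≤ θ)
    (hθ : θ * (MF * (4 * (MF + Mw) * (1 + Mw / L) + 4 * Mw)) ≤ L ^ 2 / 18)
    {k : ℕ} (hk0 : 0 < k) (hk : 6 * Mw ≤ k * L) (z : ℕ → E)
    (hz : ∀ i < 2 * k, AccurateStep F w dF dw (MF + Mw) θ u (z i) (z (i + 1))) :
    ∃ i, 1 ≤ i ∧ i ≤ 2 * k ∧ ‖dF (z i)‖ ≤ L * ‖z 0 - u‖ / 3 := by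
  by_contra! hcon
  set D := ‖z 0 - u‖ with hD
  set Δ : ℕ → ℝ := fun i => F (z i) - F u with hΔ
  have hΔ0 : ∀ i, 0 ≤ Δ i := fun i => by simp only [hΔ]; linarith [hu (z i)]
  have hmono : ∀ i, i ≤ 2 * k → Δ i ≤ Δ 0 := by
    intro i
    induction i with
    | zero => intro _; exact le_rfl
    | succ i ih =>
      intro hi
      have := (hz i (by omega)).mono
      have := ih (by omega)
      simp only [hΔ] at *
      linarith
  have hmono' : ∀ j, ∀ i, i + j ≤ 2 * k → Δ (i + j) ≤ Δ i := by
    intro j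
    induction j with
    | zero => intro i _; exact le_rfl
    | succ j ih =>
      intro i hi
      have h1 := (hz (i + j) (by omega)).mono
      have h2 := ih i (by omega)
      simp only [hΔ] at *
      rw [← add_assoc]
      linarith
  have hinit : Δ 0 ≤ MF / 2 * D ^ 2 := (hF.dist_sq_le hMF hu (z 0)).2
  set P := 2 * (MF + Mw) * (θ * Δ 0) with hP
  have hG : ∀ i < 2 * k, ‖surrGrad dF dw (z i) (z (i + 1))‖ ^ 2 ≤ P := fun i hi =>
    (hz i hi).grad.trans (by rw [hP]; gcongr; exact hmono i hi.le)
  -- First half: `surr_step` telescopes.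
  have hsum1 : ∀ j ≤ k, ∑ i ∈ Finset.range j, Δ (i + 1) + breg w dw u (z j) ≤
      breg w dw u (z 0) + j * (P / (2 * L)) := by
    intro j
    induction j with
    | zero => intro _; simp
    | succ j ih =>
      intro hj
      have h1 := ih (by omega)
      have h2 := surr_step (w := w) (dw := dw) hF hL u (z j) (z (j + 1))
      have h3 := hG j (by omega)
      have h4 : ‖surrGrad dF dw (z j) (z (j + 1))‖ ^ 2 / (2 * L) ≤ P / (2 * L) := by gcongr
      have h5 := (hw (z j) (z (j + 1))).1
      rw [Finset.sum_range_succ]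
      push_cast
      simp only [hΔ] at *
      linarith
  have hk' : (0 : ℝ) < k := by exact_mod_cast hk0
  have hA : k * Δ k ≤ Mw / 2 * D ^ 2 + k * (P / (2 * L)) := by
    have h1 := hsum1 k le_rfl
    have h2 : ∑ i ∈ Finset.range k, Δ k ≤ ∑ i ∈ Finset.range k, Δ (i + 1) := by
      apply Finset.sum_le_sum
      intro i hi
      rw [Finset.mem_range] at hi
      have := hmono' (k - (i + 1)) (i + 1) (by omega)
      rwa [show i + 1 + (k - (i + 1)) = k by omega] at this
    rw [Finset.sum_const, Finset.card_range, nsmul_eq_mul] at h2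
    have h3 := (hw (z 0) u).2
    rw [norm_sub_rev] at h3
    have h4 := (hw (z k) u).1
    simp only [zero_div, zero_mul] at h4
    linarith
  -- Second half: each divergence is paid for by the decrease of `F`.
  have hsum2 : ∀ j ≤ k, ∑ i ∈ Finset.range j, breg w dw (z (k + i + 1)) (z (k + i)) + Δ (k + j) ≤
      Δ k + j * (θ * Δ 0) := by
    intro j
    induction j with
    | zero => intro _; simp
    | succ j ih =>
      intro hj
      have h1 := ih (by omega)
      have h2 := (hz (k + j) (by omega)).decrease
      have h3 : θ * Δ (k + j) ≤ θ * Δ 0 := by gcongr; exact hmono _ (by omega)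
      rw [Finset.sum_range_succ]
      push_cast
      simp only [hΔ, surr, ← add_assoc] at *
      linarith
  have hB := hsum2 k le_rfl
  have hterm : ∀ i ∈ Finset.range k, L ^ 2 * D ^ 2 / 9 ≤
      2 * P + 4 * Mw * breg w dw (z (k + i + 1)) (z (k + i)) := by
    intro i hi
    rw [Finset.mem_range] at hi
    have h1 := hcon (k + i + 1) (by omega) (by omega)
    have h2 := hw.cocoercive hMw (z (k + i + 1)) (z (k + i))
    have h3 := hG (k + i) (by omega)
    have h4 : dF (z (k + i + 1)) = surrGrad dF dw (z (k + i)) (z (k + i + 1)) -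
        (dw (z (k + i + 1)) - dw (z (k + i))) := by simp only [surrGrad]; abel
    have h5 : ‖dF (z (k + i + 1))‖ ≤ ‖surrGrad dF dw (z (k + i)) (z (k + i + 1))‖ +
        ‖dw (z (k + i + 1)) - dw (z (k + i))‖ := by rw [h4]; exact norm_sub_le _ _
    have h6 : (L * D / 3) ^ 2 ≤ (‖surrGrad dF dw (z (k + i)) (z (k + i + 1))‖ +
        ‖dw (z (k + i + 1)) - dw (z (k + i))‖) ^ 2 := by
      have : 0 ≤ L * D / 3 := by positivity
      gcongr
      linarith
    nlinarith [sq_nonneg (‖surrGrad dF dw (z (k + i)) (z (k + i + 1))‖ -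
        ‖dw (z (k + i + 1)) - dw (z (k + i))‖)]
  have hC := Finset.sum_le_sum hterm
  rw [Finset.sum_const, Finset.card_range, nsmul_eq_mul, Finset.sum_add_distrib, Finset.sum_const,
    Finset.card_range, nsmul_eq_mul, ← Finset.mul_sum] at hC
  -- If `D = 0` the gap is 0 at the start and stays 0, so the gradient at `z 1` vanishes, contrary
  -- to `hcon`.
  have hD0 : 0 < D := by
    by_contra hD0
    have hD0 : D = 0 := le_antisymm (not_lt.1 hD0) (norm_nonneg _)
    have h1 := hcon 1 le_rfl (by omega)
    have h2 := hF.norm_grad_sq_le hMF hu (z 1)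
    have h3 := hmono 1 (by omega)
    have h4 : ‖dF (z 1)‖ ^ 2 ≤ 0 := by
      rw [hD0] at hinit
      refine h2.trans ?_
      have : F (z 1) - F u ≤ 0 := by simp only [hΔ] at *; linarith
      nlinarith
    rw [hD0] at h1
    simp only [mul_zero, zero_div] at h1
    nlinarith
  have hC2 : k * (L ^ 2 * D ^ 2 / 9) ≤ k * (2 * P) + 4 * Mw * (Δ k + k * (θ * Δ 0)) := by
    have := mul_le_mul_of_nonneg_left hB (by linarith : 0 ≤ 4 * Mw)
    have := mul_nonneg (by linarith : 0 ≤ 4 * Mw) (hΔ0 (k + k))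
    linarith
  exact stopping_arith hL hMF hMw hθ0 hθ (by exact_mod_cast hk0) hk hD0 (hΔ0 0) hinit hA hC2

end Bregman

/-! ### Smoothness, quadratic growth and the Monteiro–Svaiter potential -/

section Smooth

variable {E : Type*} [NormedAddCommGroup E] [InnerProductSpace ℝ E]

lemma hasDerivAt_along_line [CompleteSpace E] {p : E → ℝ} {dp : E → E}
    (hp : ∀ x, HasGradientAt p (dp x) x) (x d : E) (t : ℝ) :
    HasDerivAt (fun t : ℝ => p (x + t • d)) (inner ℝ (dp (x + t • d)) d) t := by
  have h1 : HasDerivAt (fun t : ℝ => x + t • d) d t := by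
    simpa using ((hasDerivAt_id t).smul_const d).const_add x
  have h2 := (hp (x + t • d)).hasFDerivAt.comp_hasDerivAt t h1
  rw [InnerProductSpace.toDual_apply_apply] at h2
  exact h2

lemma breg_le_of_lipschitz [CompleteSpace E] {p : E → ℝ} {dp : E → E} {K : ℝ}
    (hp : ∀ x, HasGradientAt p (dp x) x) (hK : ∀ x y, ‖dp x - dp y‖ ≤ K * ‖x - y‖) (y x : E) :
    breg p dp y x ≤ K / 2 * ‖y - x‖ ^ 2 := by
  set d := y - x with hd
  set ψ : ℝ → ℝ := fun t => p (x + t • d) - t * inner ℝ (dp x) d - K / 2 * ‖d‖ ^ 2 * t ^ 2 with hψ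
  have hder : ∀ t, HasDerivAt ψ
      (inner ℝ (dp (x + t • d)) d - inner ℝ (dp x) d - K * ‖d‖ ^ 2 * t) t := by
    intro t
    have h1 := ((hasDerivAt_along_line hp x d t).sub
      ((hasDerivAt_id t).mul_const (inner ℝ (dp x) d))).sub
      (((hasDerivAt_id t).pow 2).const_mul (K / 2 * ‖d‖ ^ 2))
    refine h1.congr_deriv ?_
    simp only [id, one_mul, Nat.cast_ofNat]
    ring
  have hanti : AntitoneOn ψ (Set.Icc 0 1) := by
    apply antitoneOn_of_deriv_nonpos (convex_Icc 0 1)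
    · exact fun t _ => (hder t).continuousAt.continuousWithinAt
    · exact fun t _ => (hder t).differentiableAt.differentiableWithinAt
    · intro t ht
      rw [interior_Icc] at ht
      rw [(hder t).deriv, ← inner_sub_left]
      have h1 := real_inner_le_norm (dp (x + t • d) - dp x) d
      have h2 := hK (x + t • d) x
      rw [add_sub_cancel_left, norm_smul, Real.norm_of_nonneg ht.1.le] at h2
      have h3 := mul_le_mul_of_nonneg_right h2 (norm_nonneg d)
      nlinarith
  have := hanti (Set.left_mem_Icc.2 zero_le_one) (Set.right_mem_Icc.2 zero_le_one) zero_le_one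
  simp only [hψ, one_smul, zero_smul, add_zero, hd, add_sub_cancel] at this
  simp only [breg]
  linarith

lemma breg_nonneg_of_convexOn [CompleteSpace E] {p : E → ℝ} {dp : E → E}
    (hp : ∀ x, HasGradientAt p (dp x) x) (hc : ConvexOn ℝ Set.univ p) (y x : E) :
    0 ≤ breg p dp y x := by
  have h1 : ConvexOn ℝ Set.univ (fun t : ℝ => p (x + t • (y - x))) := by
    have := hc.comp_affineMap (AffineMap.lineMap x y : ℝ →ᵃ[ℝ] E)
    simp only [Set.preimage_univ] at this
    refine this.congr fun t _ => ?_
    simp [AffineMap.lineMap_apply, add_comm]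
  have h2 := h1.le_slope_of_hasDerivAt (Set.mem_univ 0) (Set.mem_univ 1) zero_lt_one
    (hasDerivAt_along_line hp x (y - x) 0)
  simp [slope] at h2
  simp only [breg]
  linarith

lemma bregBounds_of_lipschitz [CompleteSpace E] {p : E → ℝ} {dp : E → E} {K : ℝ}
    (hp : ∀ x, HasGradientAt p (dp x) x) (hK : ∀ x y, ‖dp x - dp y‖ ≤ K * ‖x - y‖) :
    BregBounds p dp (-K) K := by
  intro x y
  refine ⟨?_, breg_le_of_lipschitz hp hK y x⟩
  have h1 : ∀ x, HasGradientAt (fun x => -p x) (-dp x) x := fun x => by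
    rw [hasGradientAt_iff_hasFDerivAt, map_neg]; exact (hp x).hasFDerivAt.neg
  have := breg_le_of_lipschitz (p := fun x => -p x) (dp := fun x => -dp x) h1
    (fun x y => by rw [neg_sub_neg, norm_sub_rev]; exact hK x y) y x
  simp only [breg, inner_neg_left] at *
  linarith

lemma BregBounds.exists_min [ProperSpace E] {p : E → ℝ} {dp : E → E} {m M : ℝ}
    (hp : BregBounds p dp m M) (hm : 0 < m) (hc : Continuous p) : ∃ v, ∀ t, p v ≤ p t := by
  apply hc.exists_forall_le
  have h1 : Filter.Tendsto (fun y : E => p 0 + ‖y‖ * (m / 2 * ‖y‖ - ‖dp 0‖))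
      (Filter.cocompact E) Filter.atTop := by
    apply Filter.tendsto_atTop_add_const_left
    have h2 := tendsto_norm_cocompact_atTop (E := E)
    exact h2.atTop_mul_atTop₀ (Filter.tendsto_atTop_add_const_right _ (-‖dp 0‖)
      (h2.const_mul_atTop (by linarith : 0 < m / 2)))
  refine Filter.tendsto_atTop_mono (fun y => ?_) h1
  have h2 := (hp 0 y).1
  have h3 : -inner ℝ (dp 0) y ≤ ‖dp 0‖ * ‖y‖ := by
    rw [← inner_neg_left, ← norm_neg (dp 0)]; exact real_inner_le_norm _ _
  simp only [breg, sub_zero] at h2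
  nlinarith

/-- `h` need not be convex: its upper bound makes the kernel convex, and its lower bound -K produces
the constant 2K. -/
lemma BregBounds.kernel {h : E → ℝ} {dh : E → E} {K : ℝ} (hh : BregBounds h dh (-K) K) :
    BregBounds (fun v => K / 2 * ‖v‖ ^ 2 - h v) (fun v => K • v - dh v) 0 (2 * K) := by
  intro x y
  have h1 := breg_sq K 0 y x
  have h2 := hh x y
  simp only [sub_zero] at h1
  have : breg (fun v => K / 2 * ‖v‖ ^ 2 - h v) (fun v => K • v - dh v) y x =
      K / 2 * ‖y - x‖ ^ 2 - breg h dh y x := by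
    rw [← h1]; simp only [breg, inner_sub_left]; ring
  rw [this]
  constructor <;> linarith

/-- Compare `u` with (1 - a)x + au, divide by 1 - a, and let a approach 1. -/
lemma quadratic_growth_of_strongConvexOn {f : E → ℝ} {μ : ℝ} (hf : StrongConvexOn Set.univ μ f)
    {u : E} (hu : ∀ x, f u ≤ f x) (x : E) : μ / 2 * ‖x - u‖ ^ 2 ≤ f x - f u := by
  set s := μ / 2 * ‖x - u‖ ^ 2 with hs
  have key : ∀ a : ℝ, 0 < a → a < 1 → a * s ≤ f x - f u := by
    intro a h0 h1
    have h2 := hf.2 (Set.mem_univ x) (Set.mem_univ u) (by linarith : 0 ≤ 1 - a) h0.le (by ring)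
    have h3 := hu ((1 - a) • x + a • u)
    simp only [smul_eq_mul, ← hs] at h2
    have h4 : (1 - a) * (a * s) ≤ (1 - a) * (f x - f u) := by nlinarith
    exact le_of_mul_le_mul_left h4 (by linarith)
  by_contra! hlt
  have h0 : 0 ≤ f x - f u := by linarith [hu x]
  have hs0 : 0 < s := by linarith
  -- Were the gap below `s`, this weight a < 1 would make a·s the midpoint of the gap and `s`,
  -- exceeding the gap.
  have := key ((f x - f u + s) / (2 * s)) (by positivity) (by
    rw [div_lt_one (by positivity)]; linarith)
  have e : (f x - f u + s) / (2 * s) * s = (f x - f u + s) / 2 := by field_simp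
  rw [e] at this
  linarith

/-- The step length of the Monteiro-Svaiter method. -/
noncomputable def msStep (L A : ℝ) : ℝ := (1 / L + Real.sqrt (1 / L ^ 2 + 4 * A / L)) / 2

/-- The weights `A_k` of the Monteiro-Svaiter method. -/
noncomputable def msWeight (L : ℝ) : ℕ → ℝ
  | 0 => 0
  | k + 1 => msWeight L k + msStep L (msWeight L k)

lemma msStep_pos {L A : ℝ} (hL : 0 < L) : 0 < msStep L A := by
  unfold msStep; positivity

/-- The step a is the positive root of La² = A + a, chosen so that the gradient terms cancel in
`ms_potential_step`. -/
lemma msStep_sq {L A : ℝ} (hL : 0 < L) (hA : 0 ≤ A) :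
    msStep L A ^ 2 = (A + msStep L A) / L := by
  unfold msStep
  have h := Real.sq_sqrt (by positivity : 0 ≤ 1 / L ^ 2 + 4 * A / L)
  set r := Real.sqrt (1 / L ^ 2 + 4 * A / L)
  have e : ((1 / L + r) / 2) ^ 2 = (1 / L ^ 2 + 2 * r / L + r ^ 2) / 4 := by ring
  rw [e, h]
  field_simp
  ring

lemma msWeight_ge {L : ℝ} (hL : 0 < L) (k : ℕ) : (k : ℝ) ^ 2 / (4 * L) ≤ msWeight L k := by
  induction k with
  | zero => simp [msWeight]
  | succ k ih =>
    have h1 : (k : ℝ) / L ≤ Real.sqrt (1 / L ^ 2 + 4 * msWeight L k / L) := by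
      apply Real.le_sqrt_of_sq_le
      have h2 : ((k : ℝ) / L) ^ 2 = 4 * ((k : ℝ) ^ 2 / (4 * L)) / L := by field_simp
      rw [h2]
      have h3 : 4 * ((k : ℝ) ^ 2 / (4 * L)) / L ≤ 4 * msWeight L k / L := by gcongr
      have : 0 ≤ 1 / L ^ 2 := by positivity
      linarith
    simp only [msWeight, msStep]
    push_cast
    have e : ((k : ℝ) + 1) ^ 2 / (4 * L) = (k : ℝ) ^ 2 / (4 * L) + (2 * (k / L) + 1 / L) / 4 := by
      field_simp; ring
    have : 0 < 1 / L := by positivity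
    linarith

lemma msWeight_nonneg {L : ℝ} (hL : 0 < L) (k : ℕ) : 0 ≤ msWeight L k :=
  le_trans (by positivity) (msWeight_ge hL k)

/-- Convexity at y' towards `y` and `u`, weighted by A and a, leaves the terms (A + a)⟨df y', x -
y'⟩ and a²‖df y'‖²/2. The stopping test makes the former dominate the latter. -/
lemma ms_potential_step {f : E → ℝ} {df : E → E} (hf : ∀ x y, 0 ≤ breg f df y x) {L A : ℝ}
    (hL : 0 < L) (hA : 0 ≤ A) (u y z x y' : E)
    (hx : x = (A / (A + msStep L A)) • y + (msStep L A / (A + msStep L A)) • z)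
    (hy' : ‖df y' + L • (y' - x)‖ ≤ L / 2 * ‖y' - x‖) :
    (A + msStep L A) * (f y' - f u) + ‖z - msStep L A • df y' - u‖ ^ 2 / 2 ≤
      A * (f y - f u) + ‖z - u‖ ^ 2 / 2 := by
  set a := msStep L A with ha
  have ha0 : 0 < a := msStep_pos hL
  have hA' : 0 < A + a := by linarith
  have hsq : a ^ 2 = (A + a) / L := msStep_sq hL hA
  have h1 := mul_nonneg hA (hf y' y)
  have h2 := mul_nonneg ha0.le (hf y' u)
  simp only [breg] at h1 h2
  have hAx : A • y + a • z = (A + a) • x := by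
    rw [hx, smul_add, smul_smul, smul_smul, mul_div_cancel₀ _ hA'.ne', mul_div_cancel₀ _ hA'.ne']
  have h3 : A * inner ℝ (df y') (y - y') + a * inner ℝ (df y') (u - y') =
      (A + a) * inner ℝ (df y') (x - y') + a * inner ℝ (df y') (u - z) := by
    simp only [← inner_smul_right, ← inner_add_right]
    congr 1
    rw [smul_sub (A + a), ← hAx]
    module
  have h4 : ‖z - a • df y' - u‖ ^ 2 =
      ‖z - u‖ ^ 2 + 2 * a * inner ℝ (df y') (u - z) + a ^ 2 * ‖df y'‖ ^ 2 := by
    have e : z - a • df y' - u = (z - u) - a • df y' := by abel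
    rw [e, norm_sub_sq_real, inner_smul_right, norm_smul, Real.norm_of_nonneg ha0.le,
      real_inner_comm, ← neg_sub u z, inner_neg_right]
    ring
  -- Squaring the test yields ‖df y'‖² ≤ 2L⟨df y', x - y'⟩.
  have h5 : ‖df y' + L • (y' - x)‖ ^ 2 ≤ (L / 2 * ‖y' - x‖) ^ 2 := by gcongr
  rw [norm_add_sq_real, inner_smul_right, norm_smul, Real.norm_of_nonneg hL.le,
    ← neg_sub x y', inner_neg_right, norm_neg] at h5
  have h6 : (A + a) / L * (‖df y'‖ ^ 2 - 2 * L * inner ℝ (df y') (x - y')) ≤ 0 := by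
    apply mul_nonpos_of_nonneg_of_nonpos (by positivity)
    nlinarith [sq_nonneg (L * ‖x - y'‖)]
  have h7 : (A + a) / L * (‖df y'‖ ^ 2 - 2 * L * inner ℝ (df y') (x - y')) =
      a ^ 2 * ‖df y'‖ ^ 2 - 2 * ((A + a) * inner ℝ (df y') (x - y')) := by
    rw [hsq]; field_simp
  rw [h7] at h6
  rw [h4]
  linarith

end Smooth

/-! ### Independence of seed blocks under the infinite product measure -/

section Resampling

variable {ι S : Type*} [MeasurableSpace S] (ν : Measure S) [IsProbabilityMeasure ν]

open Classical in
-- Both measures agree on boxes, where the product splits into indices inside and outside `J`.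
-- Independence of the seeds is used in this resampling form.
lemma infinitePi_map_piecewise (J : Set ι) :
    ((Measure.infinitePi fun _ : ι => ν).prod (Measure.infinitePi fun _ : ι => ν)).map
      (fun p i => if i ∈ J then p.2 i else p.1 i) = Measure.infinitePi fun _ : ι => ν := by
  have hm : Measurable fun (p : (ι → S) × (ι → S)) (i : ι) => if i ∈ J then p.2 i else p.1 i := by
    refine measurable_pi_lambda _ fun i => ?_
    by_cases hi : i ∈ J
    · simp only [hi, if_true]; fun_prop
    · simp only [hi, if_false]; fun_prop
  refine Measure.eq_infinitePi _ fun s t ht => ?_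
  rw [Measure.map_apply hm (MeasurableSet.pi s.countable_toSet fun i _ => ht i)]
  have : (fun (p : (ι → S) × (ι → S)) (i : ι) => if i ∈ J then p.2 i else p.1 i) ⁻¹'
      Set.pi s t = Set.pi (s.filter (· ∉ J) : Finset ι) t ×ˢ
        Set.pi (s.filter (· ∈ J) : Finset ι) t := by
    ext p
    simp only [Set.mem_preimage, Set.mem_pi, Set.mem_prod, Finset.mem_coe, Finset.mem_filter]
    constructor
    · intro hp
      exact ⟨fun i hi => by simpa [hi.2] using hp i hi.1, fun i hi => by
        simpa [hi.2] using hp i hi.1⟩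
    · rintro ⟨h1, h2⟩ i hi
      by_cases hJ : i ∈ J
      · simpa [hJ] using h2 i ⟨hi, hJ⟩
      · simpa [hJ] using h1 i ⟨hi, hJ⟩
  rw [this, Measure.prod_prod, Measure.infinitePi_pi _ fun i _ => ht i,
    Measure.infinitePi_pi _ fun i _ => ht i, mul_comm, Finset.prod_filter_mul_prod_filter_not]

/-- Resample the coordinates in `J`: `Φ` does not notice, and `Ψ` sees only the fresh copy. -/
lemma lintegral_infinitePi_of_disjoint {X Y : Type*} [MeasurableSpace X] [MeasurableSpace Y]
    (J : Set ι) {Φ : (ι → S) → X} {Ψ : (ι → S) → Y} (hΦm : Measurable Φ) (hΨm : Measurable Ψ)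
    (hΦ : ∀ ω ω', (∀ i ∉ J, ω i = ω' i) → Φ ω = Φ ω')
    (hΨ : ∀ ω ω', (∀ i ∈ J, ω i = ω' i) → Ψ ω = Ψ ω')
    {G : X → Y → ENNReal} (hG : Measurable (Function.uncurry G)) :
    ∫⁻ ω, G (Φ ω) (Ψ ω) ∂(Measure.infinitePi fun _ : ι => ν) =
      ∫⁻ ω, ∫⁻ ω', G (Φ ω) (Ψ ω') ∂(Measure.infinitePi fun _ : ι => ν)
        ∂(Measure.infinitePi fun _ : ι => ν) := by
  classical
  have hm : Measurable fun (p : (ι → S) × (ι → S)) (i : ι) => if i ∈ J then p.2 i else p.1 i := by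
    refine measurable_pi_lambda _ fun i => ?_
    by_cases hi : i ∈ J
    · simp only [hi, if_true]; fun_prop
    · simp only [hi, if_false]; fun_prop
  have hG1 : Measurable fun ω => G (Φ ω) (Ψ ω) := hG.comp (hΦm.prodMk hΨm)
  have hG2 : Measurable fun p : (ι → S) × (ι → S) => G (Φ p.1) (Ψ p.2) :=
    hG.comp ((hΦm.comp measurable_fst).prodMk (hΨm.comp measurable_snd))
  conv_lhs => rw [← infinitePi_map_piecewise ν J]
  rw [lintegral_map hG1 hm, ← lintegral_prod (fun p : (ι → S) × (ι → S) => G (Φ p.1) (Ψ p.2))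
    hG2.aemeasurable]
  refine lintegral_congr fun p => ?_
  rw [hΦ _ p.1 fun i hi => by simp [hi], hΨ _ p.2 fun i hi => by simp [hi]]

lemma infinitePi_map_comp {κ : Type*} {e : κ → ι} (he : Function.Injective e) :
    (Measure.infinitePi fun _ : ι => ν).map (fun ω k => ω (e k)) =
      Measure.infinitePi fun _ : κ => ν := by
  classical
  refine Measure.eq_infinitePi _ fun s t ht => ?_
  have hm : Measurable fun (ω : ι → S) (k : κ) => ω (e k) := by fun_prop
  rw [Measure.map_apply hm (MeasurableSet.pi s.countable_toSet fun i _ => ht i)]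
  -- `Function.invFun` below needs a nonempty index type.
  rcases isEmpty_or_nonempty κ with hκ | hκ
  · have : s = ∅ := Finset.eq_empty_of_isEmpty s
    subst this
    simp
  have : (fun (ω : ι → S) (k : κ) => ω (e k)) ⁻¹' Set.pi s t =
      Set.pi (s.image e : Finset ι) (fun i => t (Function.invFun e i)) := by
    ext ω
    simp [Set.mem_pi, Function.leftInverse_invFun he _]
  rw [this, Measure.infinitePi_pi _ fun i _ => ht _, Finset.prod_image (by simpa using he.injOn)]
  refine Finset.prod_congr rfl fun k _ => ?_
  rw [Function.leftInverse_invFun he k]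

lemma lintegral_infinitePi_eval {X : Type*} [MeasurableSpace X] (i : ι) {Φ : (ι → S) → X}
    (hΦm : Measurable Φ) (hΦ : ∀ ω ω', (∀ j ≠ i, ω j = ω' j) → Φ ω = Φ ω')
    {G : X → S → ENNReal} (hG : Measurable (Function.uncurry G)) :
    ∫⁻ ω, G (Φ ω) (ω i) ∂(Measure.infinitePi fun _ : ι => ν) =
      ∫⁻ ω, ∫⁻ s, G (Φ ω) s ∂ν ∂(Measure.infinitePi fun _ : ι => ν) := by
  rw [lintegral_infinitePi_of_disjoint ν {i} (Ψ := fun ω => ω i) hΦm (measurable_pi_apply i)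
    hΦ (fun ω ω' h => h i rfl) hG]
  refine lintegral_congr fun ω => ?_
  exact (measurePreserving_eval_infinitePi (fun _ : ι => ν) i).lintegral_comp
    (f := G (Φ ω)) (hG.comp (measurable_const.prodMk measurable_id))

/-- Meant for the seed block of one middle-loop call, with `Φ` the starting point of that call. -/
lemma lintegral_infinitePi_block {X κ : Type*} [MeasurableSpace X] {e : κ → ι}
    (he : Function.Injective e) {Φ : (ι → S) → X} (hΦm : Measurable Φ)
    (hΦ : ∀ ω ω', (∀ j, j ∉ Set.range e → ω j = ω' j) → Φ ω = Φ ω')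
    {G : X → (κ → S) → ENNReal} (hG : Measurable (Function.uncurry G)) :
    ∫⁻ ω, G (Φ ω) (fun k => ω (e k)) ∂(Measure.infinitePi fun _ : ι => ν) =
      ∫⁻ ω, ∫⁻ s, G (Φ ω) s ∂(Measure.infinitePi fun _ : κ => ν)
        ∂(Measure.infinitePi fun _ : ι => ν) := by
  have hm : Measurable fun (ω : ι → S) (k : κ) => ω (e k) := by fun_prop
  rw [lintegral_infinitePi_of_disjoint ν (Set.range e) (Ψ := fun ω k => ω (e k)) hΦm hm
    hΦ (fun ω ω' h => funext fun k => h _ ⟨k, rfl⟩) hG]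
  refine lintegral_congr fun ω => ?_
  rw [← infinitePi_map_comp ν he,
    lintegral_map (f := G (Φ ω)) (hG.comp (measurable_const.prodMk measurable_id)) hm]

end Resampling

/-! ### Expected residual of one inner run -/

section InnerStep

variable {n : ℕ} {g : Vec n → ℝ} {κ : ℕ} {Q A S : Type*} [MeasurableSpace S] {ν : Measure S}
  {answer : Q → A} {c C τ α : ℝ}

/-- Taking ε' proportional to ‖v₀ - v‖² turns the logarithm into log Y², so one fixed budget serves
every inner problem. -/
lemma InnerMethod.integral_residual_le (M : InnerMethod g answer ν α c C τ)
    (hC : 0 < C) {Y : ℝ} (hY : 0 < Y) {N : ℕ}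
    (hN : c * (τ / Real.sqrt α) * Real.log (Y ^ 2) ≤ N) (β v₀ v : Vec n)
    (hv : ∀ t, innerObj g α β v ≤ innerObj g α β t) :
    ∫⁻ s, ENNReal.ofReal (innerObj g α β ((M.prog β v₀ N s).output answer) - innerObj g α β v) ∂ν
      ≤ ENNReal.ofReal (C / Y ^ 2 * ‖v₀ - v‖ ^ 2) := by
  have key : ∀ ε', 0 < ε' → c * (τ / Real.sqrt α) * Real.log (C * ‖v₀ - v‖ ^ 2 / ε') ≤ N →
      ∫⁻ s, ENNReal.ofReal (innerObj g α β ((M.prog β v₀ N s).output answer)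
        - innerObj g α β v) ∂ν ≤ ENNReal.ofReal ε' := by
    intro ε' hε' hle
    obtain ⟨h1, h2⟩ := M.rate β v₀ v ε' N hε' hv hle
    rw [← ofReal_integral_eq_lintegral_ofReal h1
      (Filter.Eventually.of_forall fun s => sub_nonneg.2 (hv _))]
    exact ENNReal.ofReal_le_ofReal h2
  rcases eq_or_ne (‖v₀ - v‖) 0 with h0 | h0
  · rw [h0]
    -- When v₀ = v the logarithm is `Real.log 0 = 0`, so the guarantee holds for every ε' > 0.
    refine ENNReal.le_of_forall_pos_le_add fun ε' hε' _ => ?_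
    have := key ε' hε' (by rw [h0]; simp)
    simpa using this
  · have hpos : 0 < ‖v₀ - v‖ := lt_of_le_of_ne (norm_nonneg _) h0.symm
    apply key _ (by positivity)
    refine le_trans (le_of_eq ?_) hN
    congr 2
    field_simp

end InnerStep

/-! ### One step of the middle loop -/

section CompositeGradient

/-- The regularized objective of the middle loop. -/
noncomputable def reg {n : ℕ} (h g : Vec n → ℝ) (L : ℝ) (x v : Vec n) : ℝ :=
  (h v + g v) + L / 2 * ‖v - x‖ ^ 2

/-- The gradient of the regularized objective. -/
noncomputable def regGrad {n : ℕ} (h g : Vec n → ℝ) (L : ℝ) (x v : Vec n) : Vec n :=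
  (gradient h v + gradient g v) + L • (v - x)

/-- The convex function whose Bregman divergence is the majorization gap of `h`. -/
noncomputable def kern {n : ℕ} (h : Vec n → ℝ) (Lh : ℝ) (v : Vec n) : ℝ :=
  Lh / 2 * ‖v‖ ^ 2 - h v

/-- The gradient of `kern`. -/
noncomputable def kernGrad {n : ℕ} (h : Vec n → ℝ) (Lh : ℝ) (v : Vec n) : Vec n :=
  Lh • v - gradient h v

/-- The regularity of `h`, `g` and the convexity of `h + g`, in terms of Bregman divergences. -/
structure SmoothSplit {n : ℕ} (h g : Vec n → ℝ) (Mf Lh : ℝ) : Prop where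
  bregF : BregBounds (fun v => h v + g v) (fun v => gradient h v + gradient g v) 0 Mf
  bregH : BregBounds h (gradient h) (-Lh) Lh
  contH : Continuous h
  contG : Continuous g
  contGradH : Continuous (gradient h)
  contGradG : Continuous (gradient g)

lemma IsSmooth.continuous_gradient {n : ℕ} {p : Vec n → ℝ} {K : ℝ} (hp : IsSmooth p K) :
    Continuous (gradient p) := by
  refine (LipschitzWith.of_dist_le_mul (K := Real.toNNReal K) fun x y => ?_).continuous
  rw [dist_eq_norm, dist_eq_norm]
  refine (hp.2 x y).trans ?_
  gcongr
  exact Real.le_coe_toNNReal K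

lemma smoothSplit_of_isSmooth {n : ℕ} {h g : Vec n → ℝ} {Lf Lh Lg : ℝ}
    (hf : IsSmooth (fun x => h x + g x) Lf) (hc : ConvexOn ℝ Set.univ (fun x => h x + g x))
    (hh : IsSmooth h Lh) (hg : IsSmooth g Lg) : SmoothSplit h g |Lf| Lh := by
  have h1 : ∀ x, HasGradientAt (fun x => h x + g x) (gradient h x + gradient g x) x := fun x => by
    rw [hasGradientAt_iff_hasFDerivAt, map_add]
    exact (hh.1 x).hasGradientAt.hasFDerivAt.add (hg.1 x).hasGradientAt.hasFDerivAt
  have h2 : gradient (fun x => h x + g x) = fun x => gradient h x + gradient g x :=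
    gradient_eq h1
  have h3 := hf.2
  rw [h2] at h3
  refine ⟨fun x y => ⟨?_, ?_⟩, bregBounds_of_lipschitz (fun x => (hh.1 x).hasGradientAt) hh.2,
    hh.1.continuous, hg.1.continuous, hh.continuous_gradient, hg.continuous_gradient⟩
  · simpa using breg_nonneg_of_convexOn h1 hc y x
  · exact breg_le_of_lipschitz h1 (fun x y => (h3 x y).trans
      (mul_le_mul_of_nonneg_right (le_abs_self _) (norm_nonneg _))) y x

variable {n : ℕ} {h g : Vec n → ℝ} {κ : ℕ} {Q A S : Type*} [MeasurableSpace S]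
  {ν : Measure S} {c C τ L Lh Mf : ℝ}

lemma SmoothSplit.reg_bounds (hs : SmoothSplit h g Mf Lh) (L : ℝ) (x : Vec n) :
    BregBounds (reg h g L x) (regGrad h g L x) L (Mf + L) := by
  have := hs.bregF.add (BregBounds.sq L x)
  rwa [zero_add] at this

lemma SmoothSplit.kern_bounds (hs : SmoothSplit h g Mf Lh) :
    BregBounds (kern h Lh) (kernGrad h Lh) 0 (2 * Lh) := hs.bregH.kernel

lemma SmoothSplit.continuous_reg (hs : SmoothSplit h g Mf Lh) (L : ℝ) (x : Vec n) :
    Continuous (reg h g L x) := by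
  have := hs.contH
  have := hs.contG
  unfold reg; fun_prop

lemma SmoothSplit.continuous_surr (hs : SmoothSplit h g Mf Lh) (L : ℝ) (x : Vec n) :
    Continuous fun p : Vec n × Vec n =>
      surr (reg h g L x) (kern h Lh) (kernGrad h Lh) p.1 p.2 := by
  have := hs.contH
  have := hs.contG
  have := hs.contGradH
  unfold surr breg reg kern kernGrad; fun_prop

/-- The objectives differ by a constant depending only on `x` and `ζ`, so inner residuals are
residuals of the Bregman surrogate. -/
lemma innerObj_sub_innerObj (x ζ v v' : Vec n) :
    innerObj g (L + Lh) (gradient h ζ - L • x - Lh • ζ) v -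
      innerObj g (L + Lh) (gradient h ζ - L • x - Lh • ζ) v' =
    surr (reg h g L x) (kern h Lh) (kernGrad h Lh) ζ v -
      surr (reg h g L x) (kern h Lh) (kernGrad h Lh) ζ v' := by
  simp only [innerObj, surr, reg, breg, kern, kernGrad, norm_sub_sq_real, inner_sub_left,
    inner_sub_right, inner_smul_left, conj_trivial, real_inner_comm]
  ring

/-- The output of one call of the inner method in the middle loop. -/
noncomputable def innerOut (h : Vec n → ℝ) (O : BasicOracle g κ Q A)
    (M : InnerMethod g O.answer ν (L + Lh) c C τ) (N : ℕ) (x ζ : Vec n) (s : S) : Vec n :=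
  (M.prog (gradient h ζ - L • x - Lh • ζ) ζ N s).output O.answer

variable (O : BasicOracle g κ Q A) (M : InnerMethod g O.answer ν (L + Lh) c C τ) (N : ℕ)

lemma measurable_innerOut (hs : SmoothSplit h g Mf Lh) :
    Measurable fun p : Vec n × Vec n × S => innerOut h O M N p.1 p.2.1 p.2.2 := by
  have := hs.contGradH.measurable
  have h1 : Measurable fun p : Vec n × Vec n × S =>
    (gradient h p.2.1 - L • p.1 - Lh • p.2.1, p.2.1, p.2.2) := by fun_prop
  exact (M.measurable_output N).comp h1

/-- The budget `N` gives the relative accuracy `q`. -/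
def RelAccurate (h : Vec n → ℝ) (O : BasicOracle g κ Q A)
    (M : InnerMethod g O.answer ν (L + Lh) c C τ) (N : ℕ) (q : ℝ) : Prop :=
  ∀ x ζ v : Vec n, (∀ t, surr (reg h g L x) (kern h Lh) (kernGrad h Lh) ζ v ≤
      surr (reg h g L x) (kern h Lh) (kernGrad h Lh) ζ t) →
    ∫⁻ s, ENNReal.ofReal (surr (reg h g L x) (kern h Lh) (kernGrad h Lh) ζ
        (innerOut h O M N x ζ s) - surr (reg h g L x) (kern h Lh) (kernGrad h Lh) ζ v) ∂ν ≤
      ENNReal.ofReal (q * ‖ζ - v‖ ^ 2)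

variable {O M N}

lemma relAccurate_of_budget (hC : 0 < C) {Y : ℝ} (hY : 0 < Y)
    (hN : c * (τ / Real.sqrt (L + Lh)) * Real.log (Y ^ 2) ≤ N) :
    RelAccurate h O M N (C / Y ^ 2) := by
  intro x ζ v hv
  have h1 := M.integral_residual_le hC hY hN (gradient h ζ - L • x - Lh • ζ) ζ v
    (fun t => by
      have := hv t
      rw [← sub_nonneg, ← innerObj_sub_innerObj] at this
      linarith)
  simp only [innerObj_sub_innerObj] at h1
  exact h1

variable {q : ℝ} {x u : Vec n}

lemma exists_residual (hs : SmoothSplit h g Mf Lh) (hMf : 0 ≤ Mf) (hL : 0 < L) (hLh : 0 < Lh)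
    (hq : RelAccurate h O M N q) (hq0 : 0 ≤ q) (hu : ∀ t, reg h g L x u ≤ reg h g L x t)
    (ζ : Vec n) :
    ∃ v, (∀ t, surr (reg h g L x) (kern h Lh) (kernGrad h Lh) ζ v ≤
      surr (reg h g L x) (kern h Lh) (kernGrad h Lh) ζ t) ∧
    ∫⁻ s, ENNReal.ofReal (surr (reg h g L x) (kern h Lh) (kernGrad h Lh) ζ
        (innerOut h O M N x ζ s) - surr (reg h g L x) (kern h Lh) (kernGrad h Lh) ζ v) ∂ν ≤
      ENNReal.ofReal (2 * q / L * (reg h g L x ζ - reg h g L x u)) := by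
  obtain ⟨v, hv⟩ := (surr_bounds (hs.reg_bounds L x) hs.kern_bounds ζ).exists_min hL
    ((hs.continuous_surr L x).comp (Continuous.prodMk_right ζ))
  refine ⟨v, hv, (hq x ζ v hv).trans (ENNReal.ofReal_le_ofReal ?_)⟩
  have h1 := surr_dist_sq_le (hs.reg_bounds L x) hs.kern_bounds (by linarith) (by linarith) hu hv
  calc q * ‖ζ - v‖ ^ 2 = 2 * q / L * (L / 2 * ‖ζ - v‖ ^ 2) := by field_simp
    _ ≤ _ := by gcongr

lemma lintegral_gap_innerOut_le (hs : SmoothSplit h g Mf Lh) (hMf : 0 ≤ Mf) (hL : 0 < L)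
    (hLh : 0 < Lh) (hq : RelAccurate h O M N q) (hq0 : 0 ≤ q)
    [IsProbabilityMeasure ν] (hu : ∀ t, reg h g L x u ≤ reg h g L x t) (ζ : Vec n) :
    ∫⁻ s, ENNReal.ofReal (reg h g L x (innerOut h O M N x ζ s) - reg h g L x u) ∂ν ≤
      ENNReal.ofReal ((1 - L / (L + 2 * Lh) + 2 * q / L) * (reg h g L x ζ - reg h g L x u)) := by
  obtain ⟨v, hv, hint⟩ := exists_residual hs hMf hL hLh hq hq0 hu ζ
  have h1 := surr_min_le (hs.reg_bounds L x) hs.kern_bounds hL (by linarith) u hv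
  have hgap : 0 ≤ reg h g L x ζ - reg h g L x u := sub_nonneg.2 (hu ζ)
  have hl : L / (L + 2 * Lh) ≤ 1 := by rw [div_le_one (by positivity)]; linarith
  calc ∫⁻ s, ENNReal.ofReal (reg h g L x (innerOut h O M N x ζ s) - reg h g L x u) ∂ν
      ≤ ∫⁻ s, (ENNReal.ofReal (surr (reg h g L x) (kern h Lh) (kernGrad h Lh) ζ
        (innerOut h O M N x ζ s) - surr (reg h g L x) (kern h Lh) (kernGrad h Lh) ζ v) +
        ENNReal.ofReal ((1 - L / (L + 2 * Lh)) * (reg h g L x ζ - reg h g L x u))) ∂ν := by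
        refine lintegral_mono fun s => ?_
        rw [← ENNReal.ofReal_add (sub_nonneg.2 (hv _)) (mul_nonneg (by linarith) hgap)]
        refine ENNReal.ofReal_le_ofReal ?_
        have := le_surr (F := reg h g L x) hs.kern_bounds ζ (innerOut h O M N x ζ s)
        linarith
    _ ≤ ENNReal.ofReal (2 * q / L * (reg h g L x ζ - reg h g L x u)) +
        ENNReal.ofReal ((1 - L / (L + 2 * Lh)) * (reg h g L x ζ - reg h g L x u)) := by
        rw [lintegral_add_right _ measurable_const, lintegral_const, measure_univ, mul_one]
        gcongr
    _ = _ := by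
        rw [← ENNReal.ofReal_add (by positivity) (mul_nonneg (by linarith) hgap)]
        congr 1; ring

/-- Markov's inequality for the residual, at the threshold θ times the current gap. -/
lemma measure_not_accurateStep_le (hs : SmoothSplit h g Mf Lh) (hMf : 0 ≤ Mf) (hL : 0 < L)
    (hLh : 0 < Lh) (hq : RelAccurate h O M N q) (hq0 : 0 ≤ q)
    (hu : ∀ t, reg h g L x u ≤ reg h g L x t)
    {θ : ℝ} (hθ0 : 0 < θ) (hθ : θ ≤ L / (L + 2 * Lh)) (ζ : Vec n) :
    ν {s | ¬ AccurateStep (reg h g L x) (kern h Lh) (regGrad h g L x) (kernGrad h Lh)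
      (Mf + L + 2 * Lh) θ u ζ (innerOut h O M N x ζ s)} ≤ ENNReal.ofReal (2 * q / (L * θ)) := by
  obtain ⟨v, hv, hint⟩ := exists_residual hs hMf hL hLh hq hq0 hu ζ
  set res : S → ℝ := fun s => surr (reg h g L x) (kern h Lh) (kernGrad h Lh) ζ
        (innerOut h O M N x ζ s) - surr (reg h g L x) (kern h Lh) (kernGrad h Lh) ζ v with hres
  have hmeas : Measurable res := by
    have h0 : Measurable fun s : S => (x, ζ, s) := by fun_prop
    have h1 := (measurable_innerOut O M N hs).comp h0
    have h2 : Continuous fun v => surr (reg h g L x) (kern h Lh) (kernGrad h Lh) ζ v :=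
      (hs.continuous_surr L x).comp (Continuous.prodMk_right ζ)
    exact (h2.measurable.comp h1).sub_const _
  have hacc : ∀ s, res s ≤ θ * (reg h g L x ζ - reg h g L x u) →
      AccurateStep (reg h g L x) (kern h Lh) (regGrad h g L x) (kernGrad h Lh)
      (Mf + L + 2 * Lh) θ u ζ (innerOut h O M N x ζ s) := fun s he =>
    accurateStep_of_residual (hs.reg_bounds L x) hs.kern_bounds hL (by linarith) (by linarith)
      hθ hu hv he
  rcases (sub_nonneg.2 (hu ζ)).eq_or_lt with h0 | h0
  -- Zero gap leaves no positive threshold for Markov, but the expected residual is then 0 and the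
  -- step is almost surely accurate.
  · rw [← h0, mul_zero, ENNReal.ofReal_zero, nonpos_iff_eq_zero,
      lintegral_eq_zero_iff hmeas.ennreal_ofReal] at hint
    refine (le_of_eq ?_).trans zero_le
    refine measure_mono_null (fun s hs' => ?_) (ae_iff.1 hint)
    simp only [Set.mem_ofPred_eq, Pi.zero_apply, ENNReal.ofReal_eq_zero, not_le] at hs' ⊢
    by_contra! hle
    exact hs' (hacc s (by rw [← h0, mul_zero]; exact hle))
  · have hpos : 0 < θ * (reg h g L x ζ - reg h g L x u) := by positivity
    calc ν _ ≤ ν {s | ENNReal.ofReal (θ * (reg h g L x ζ - reg h g L x u)) ≤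
          ENNReal.ofReal (res s)} := by
          refine measure_mono fun s hs' => ?_
          by_contra! hlt
          simp only [Set.mem_ofPred_eq, not_le] at hlt
          exact hs' (hacc s ((ENNReal.ofReal_lt_ofReal_iff hpos).1 hlt).le)
      _ ≤ (∫⁻ s, ENNReal.ofReal (res s) ∂ν) /
          ENNReal.ofReal (θ * (reg h g L x ζ - reg h g L x u)) :=
          meas_ge_le_lintegral_div hmeas.ennreal_ofReal.aemeasurable
            (by simpa using hpos) ENNReal.ofReal_ne_top
      _ ≤ ENNReal.ofReal (2 * q / L * (reg h g L x ζ - reg h g L x u)) /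
          ENNReal.ofReal (θ * (reg h g L x ζ - reg h g L x u)) := by gcongr
      _ = _ := by
          rw [← ENNReal.ofReal_div_of_pos hpos]
          congr 1
          field_simp

end CompositeGradient

/-! ### Two tail bounds for the middle loop -/

section CompositeGradientRun

variable {n : ℕ} {h g : Vec n → ℝ} {κ : ℕ} {Q A S : Type*} [MeasurableSpace S]
  {ν : Measure S} {c C τ L Lh Mf : ℝ}

/-- The iterates of the composite gradient method. -/
noncomputable def gmcoPt (h : Vec n → ℝ) (O : BasicOracle g κ Q A)
    (M : InnerMethod g O.answer ν (L + Lh) c C τ) (N : ℕ) (x : Vec n) (s : ℕ → S) (k : ℕ) : Vec n :=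
  (gmcoIter h O M N x s k).point

variable (O : BasicOracle g κ Q A) (M : InnerMethod g O.answer ν (L + Lh) c C τ) (N : ℕ)

lemma gmcoPt_zero (x : Vec n) (s : ℕ → S) : gmcoPt h O M N x s 0 = x := rfl

lemma gmcoPt_succ (x : Vec n) (s : ℕ → S) (k : ℕ) :
    gmcoPt h O M N x s (k + 1) = innerOut h O M N x (gmcoPt h O M N x s k) (s k) := rfl

lemma gmcoPt_congr (x : Vec n) {s s' : ℕ → S} {k : ℕ} (hs : ∀ j < k, s j = s' j) :
    gmcoPt h O M N x s k = gmcoPt h O M N x s' k := by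
  induction k with
  | zero => rfl
  | succ k ih =>
    rw [gmcoPt_succ, gmcoPt_succ, ih fun j hj => hs j (by omega), hs k (by omega)]

lemma measurable_gmcoPt (hs : SmoothSplit h g Mf Lh) (k : ℕ) :
    Measurable fun p : Vec n × (ℕ → S) => gmcoPt h O M N p.1 p.2 k := by
  induction k with
  | zero => exact measurable_fst
  | succ k ih =>
    have h1 : Measurable fun p : Vec n × (ℕ → S) => (p.1, gmcoPt h O M N p.1 p.2 k, p.2 k) := by
      fun_prop
    have h2 := (measurable_innerOut O M N hs).comp h1
    exact h2

lemma measurable_gmcoPt_right (hs : SmoothSplit h g Mf Lh) (x : Vec n) (k : ℕ) :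
    Measurable fun s : ℕ → S => gmcoPt h O M N x s k := by
  have h0 : Measurable fun s : ℕ → S => (x, s) := by fun_prop
  have h1 := (measurable_gmcoPt O M N hs k).comp h0
  exact h1

lemma gmcoStop_iff (x ζ : Vec n) :
    gmcoStop h O L x ζ ↔ ‖regGrad h g L x ζ‖ ≤ L / 2 * ‖ζ - x‖ := by
  rw [gmcoStop, O.grad_output, regGrad]

lemma measurableSet_gmcoStop (hs : SmoothSplit h g Mf Lh) (k : ℕ) :
    MeasurableSet {p : Vec n × (ℕ → S) | gmcoStop h O L p.1 (gmcoPt h O M N p.1 p.2 k)} := by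
  have h1 := measurable_gmcoPt O M N hs k
  have h2 := hs.contGradH.measurable
  have h3 := hs.contGradG.measurable
  simp only [gmcoStop_iff, regGrad]
  apply measurableSet_le <;> fun_prop

variable {O M N} {q : ℝ} {x u : Vec n} [IsProbabilityMeasure ν]

/-- Strong convexity gives L‖ζ - u‖ ≤ ‖∇F ζ‖, so ‖∇F ζ‖ ≤ (L‖ζ - x‖ + ‖∇F ζ‖)/3; solving turns 1/3
into the 1/2 of the test. -/
lemma gmcoStop_of_small_grad (hs : SmoothSplit h g Mf Lh) (hMf : 0 ≤ Mf) (hL : 0 < L)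
    (hu : ∀ t, reg h g L x u ≤ reg h g L x t) {ζ : Vec n}
    (hζ : ‖regGrad h g L x ζ‖ ≤ L * ‖x - u‖ / 3) : gmcoStop h O L x ζ := by
  rw [gmcoStop_iff]
  have h1 := (hs.reg_bounds L x).dist_le (by linarith) hu ζ
  have h2 : ‖x - u‖ ≤ ‖ζ - x‖ + ‖ζ - u‖ := by
    rw [norm_sub_rev ζ x]
    exact norm_sub_le_norm_sub_add_norm_sub x ζ u
  nlinarith

lemma gmcoStop_of_small_gap (hs : SmoothSplit h g Mf Lh) (hMf : 0 ≤ Mf) (hL : 0 < L)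
    (hu : ∀ t, reg h g L x u ≤ reg h g L x t) {ζ : Vec n}
    (hζ : reg h g L x ζ - reg h g L x u ≤ L ^ 2 * ‖x - u‖ ^ 2 / (18 * (Mf + L))) :
    gmcoStop h O L x ζ := by
  refine gmcoStop_of_small_grad hs hMf hL hu ?_
  have hM : 0 < Mf + L := by linarith
  have h1 := (hs.reg_bounds L x).norm_grad_sq_le hM hu ζ
  refine abs_le_of_sq_le_sq' ?_ (by positivity) |>.2
  calc ‖regGrad h g L x ζ‖ ^ 2 ≤ 2 * (Mf + L) * (L ^ 2 * ‖x - u‖ ^ 2 / (18 * (Mf + L))) :=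
        h1.trans (by gcongr)
    _ = _ := by field_simp; ring

/-- Iterate `k` depends only on the seeds before `k`, so seed `k` can be integrated out first and
the one-step contraction iterates. -/
lemma lintegral_gap_le (hs : SmoothSplit h g Mf Lh) (hMf : 0 ≤ Mf) (hL : 0 < L)
    (hLh : 0 < Lh) (hq : RelAccurate h O M N q) (hq0 : 0 ≤ q)
    (hu : ∀ t, reg h g L x u ≤ reg h g L x t) {r : ℝ} (hr0 : 0 ≤ r)
    (hr : 1 - L / (L + 2 * Lh) + 2 * q / L ≤ r) (k : ℕ) :
    ∫⁻ s, ENNReal.ofReal (reg h g L x (gmcoPt h O M N x s k) - reg h g L x u)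
      ∂(Measure.infinitePi fun _ : ℕ => ν) ≤
      ENNReal.ofReal (r ^ k * (reg h g L x x - reg h g L x u)) := by
  have hregm := (hs.continuous_reg L x).measurable
  induction k with
  | zero => simp [gmcoPt_zero]
  | succ k ih =>
    have hG : Measurable (Function.uncurry fun (ζ : Vec n) (s : S) =>
        ENNReal.ofReal (reg h g L x (innerOut h O M N x ζ s) - reg h g L x u)) := by
      have h0 : Measurable fun p : Vec n × S => (x, p.1, p.2) := by fun_prop
      have h1 := hregm.comp ((measurable_innerOut O M N hs).comp h0)
      exact (h1.sub_const _).ennreal_ofReal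
    have h1 := lintegral_infinitePi_eval ν k (measurable_gmcoPt_right O M N hs x k)
      (fun ω ω' h => gmcoPt_congr O M N x fun j hj => h j hj.ne) hG
    simp only [gmcoPt_succ]
    rw [h1]
    calc _ ≤ ∫⁻ s, ENNReal.ofReal r *
          ENNReal.ofReal (reg h g L x (gmcoPt h O M N x s k) - reg h g L x u)
          ∂(Measure.infinitePi fun _ : ℕ => ν) := by
          refine lintegral_mono fun s => ?_
          rw [← ENNReal.ofReal_mul hr0]
          refine (lintegral_gap_innerOut_le hs hMf hL hLh hq hq0 hu _).trans
            (ENNReal.ofReal_le_ofReal ?_)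
          exact mul_le_mul_of_nonneg_right hr (sub_nonneg.2 (hu _))
      _ ≤ ENNReal.ofReal r * ENNReal.ofReal (r ^ k * (reg h g L x x - reg h g L x u)) := by
          rw [lintegral_const_mul' _ _ ENNReal.ofReal_ne_top]
          gcongr
      _ = _ := by rw [← ENNReal.ofReal_mul hr0, pow_succ']; congr 1; ring

/-- Markov for the gap. The initial gap and the gap sufficient for stopping both scale with ‖x -
u‖², so the starting point drops out. -/
lemma measure_not_stop_le_geometric (hs : SmoothSplit h g Mf Lh) (hMf : 0 ≤ Mf) (hL : 0 < L)
    (hLh : 0 < Lh) (hq : RelAccurate h O M N q) (hq0 : 0 ≤ q)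
    (hu : ∀ t, reg h g L x u ≤ reg h g L x t) {r : ℝ} (hr0 : 0 ≤ r)
    (hr : 1 - L / (L + 2 * Lh) + 2 * q / L ≤ r) (k : ℕ) :
    (Measure.infinitePi fun _ : ℕ => ν) {s | ¬ gmcoStop h O L x (gmcoPt h O M N x s k)} ≤
      ENNReal.ofReal (9 * (Mf + L) ^ 2 / L ^ 2 * r ^ k) := by
  have hM : 0 < Mf + L := by linarith
  have h1 := lintegral_gap_le hs hMf hL hLh hq hq0 hu hr0 hr k
  have h2 := ((hs.reg_bounds L x).dist_sq_le hM hu x).2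
  have hmeas : Measurable fun s : ℕ → S => reg h g L x (gmcoPt h O M N x s k) - reg h g L x u :=
    ((hs.continuous_reg L x).measurable.comp (measurable_gmcoPt_right O M N hs x k)).sub_const _
  have h3 : ∀ s, ¬ gmcoStop h O L x (gmcoPt h O M N x s k) →
      L ^ 2 * ‖x - u‖ ^ 2 / (18 * (Mf + L)) <
        reg h g L x (gmcoPt h O M N x s k) - reg h g L x u := fun s hns => by
    by_contra! hle
    exact hns (gmcoStop_of_small_gap hs hMf hL hu hle)
  rcases (norm_nonneg (x - u)).eq_or_lt with h0 | h0
  · rw [← h0] at h2 h3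
    have h4 : reg h g L x x - reg h g L x u = 0 :=
      le_antisymm (by simpa using h2) (sub_nonneg.2 (hu x))
    rw [h4, mul_zero, ENNReal.ofReal_zero, nonpos_iff_eq_zero,
      lintegral_eq_zero_iff hmeas.ennreal_ofReal] at h1
    refine (le_of_eq ?_).trans zero_le
    refine measure_mono_null (fun s hs' => ?_) (ae_iff.1 h1)
    simpa using h3 s hs'
  · have hpos : 0 < L ^ 2 * ‖x - u‖ ^ 2 / (18 * (Mf + L)) := by positivity
    calc _ ≤ (Measure.infinitePi fun _ : ℕ => ν)
          {s | ENNReal.ofReal (L ^ 2 * ‖x - u‖ ^ 2 / (18 * (Mf + L))) ≤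
            ENNReal.ofReal (reg h g L x (gmcoPt h O M N x s k) - reg h g L x u)} :=
          measure_mono fun s hs' => ENNReal.ofReal_le_ofReal (h3 s hs').le
      _ ≤ _ := meas_ge_le_lintegral_div hmeas.ennreal_ofReal.aemeasurable
            (by simpa using hpos) ENNReal.ofReal_ne_top
      _ ≤ ENNReal.ofReal (r ^ k * ((Mf + L) / 2 * ‖x - u‖ ^ 2)) /
          ENNReal.ofReal (L ^ 2 * ‖x - u‖ ^ 2 / (18 * (Mf + L))) := by
          gcongr
          refine h1.trans (ENNReal.ofReal_le_ofReal ?_)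
          gcongr
      _ = _ := by
          rw [← ENNReal.ofReal_div_of_pos hpos]
          congr 1
          field_simp
          ring

/-- By `exists_small_grad` some of the 2k steps must be inaccurate; a union bound over them follows.
-/
lemma measure_no_stop_le (hs : SmoothSplit h g Mf Lh) (hMf : 0 ≤ Mf) (hL : 0 < L)
    (hLh : 0 < Lh) (hq : RelAccurate h O M N q) (hq0 : 0 ≤ q)
    (hu : ∀ t, reg h g L x u ≤ reg h g L x t) {θ : ℝ} (hθ0 : 0 < θ) (hθ : θ ≤ L / (L + 2 * Lh))
    (hθ' : θ * ((Mf + L) * (4 * (Mf + L + 2 * Lh) * (1 + 2 * Lh / L) + 4 * (2 * Lh))) ≤ L ^ 2 / 18)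
    {k : ℕ} (hk0 : 0 < k) (hk : 6 * (2 * Lh) ≤ k * L) :
    (Measure.infinitePi fun _ : ℕ => ν)
      {s | ∀ j, 1 ≤ j → j ≤ 2 * k → ¬ gmcoStop h O L x (gmcoPt h O M N x s j)} ≤
      ENNReal.ofReal (2 * k * (2 * q / (L * θ))) := by
  set P := Measure.infinitePi fun _ : ℕ => ν
  set bad : Vec n → Vec n → Prop := fun ζ ζ' => ¬ AccurateStep (reg h g L x) (kern h Lh)
    (regGrad h g L x) (kernGrad h Lh) (Mf + L + 2 * Lh) θ u ζ ζ' with hbad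
  have hbadm : MeasurableSet {p : Vec n × Vec n | bad p.1 p.2} := by
    have h1 := (hs.continuous_reg L x).measurable
    have h2 := (hs.continuous_surr L x).measurable
    have h3 := hs.contGradH.measurable
    have h4 := hs.contGradG.measurable
    have h5 : {p : Vec n × Vec n | bad p.1 p.2} =
      ({p : Vec n × Vec n | ‖surrGrad (regGrad h g L x) (kernGrad h Lh) p.1 p.2‖ ^ 2 ≤
          2 * (Mf + L + 2 * Lh) * (θ * (reg h g L x p.1 - reg h g L x u))} ∩
        {p | surr (reg h g L x) (kern h Lh) (kernGrad h Lh) p.1 p.2 ≤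
          reg h g L x p.1 + θ * (reg h g L x p.1 - reg h g L x u)} ∩
        {p | reg h g L x p.2 ≤ reg h g L x p.1})ᶜ := by
      ext p
      simp only [hbad, Set.mem_compl_iff, Set.mem_inter_iff, Set.mem_ofPred_eq, not_iff_not]
      exact ⟨fun h => ⟨⟨h.grad, h.decrease⟩, h.mono⟩, fun h => ⟨h.1.1, h.1.2, h.2⟩⟩
    rw [h5]
    refine ((measurableSet_le ?_ ?_).inter (measurableSet_le h2 ?_)).inter (measurableSet_le ?_ ?_) |>.compl
    · simp only [surrGrad, regGrad, kernGrad]; fun_prop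
    all_goals fun_prop
  have hstep : ∀ i, P {s | bad (gmcoPt h O M N x s i) (gmcoPt h O M N x s (i + 1))} ≤
      ENNReal.ofReal (2 * q / (L * θ)) := by
    intro i
    have hG0 : Measurable fun p : Vec n × S => (p.1, innerOut h O M N x p.1 p.2) := by
      have h0 : Measurable fun p : Vec n × S => (x, p.1, p.2) := by fun_prop
      have h1 := (measurable_innerOut O M N hs).comp h0
      exact measurable_fst.prodMk h1
    have hset : MeasurableSet {p : Vec n × S | bad p.1 (innerOut h O M N x p.1 p.2)} := hG0 hbadm
    have hm1 : MeasurableSet {s | bad (gmcoPt h O M N x s i) (gmcoPt h O M N x s (i + 1))} :=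
      ((measurable_gmcoPt_right O M N hs x i).prodMk
        (measurable_gmcoPt_right O M N hs x (i + 1))) hbadm
    have hG : Measurable (Function.uncurry fun (ζ : Vec n) (s : S) =>
        {p : Vec n × S | bad p.1 (innerOut h O M N x p.1 p.2)}.indicator
          (fun _ => (1 : ENNReal)) (ζ, s)) := measurable_const.indicator hset
    have h1 := lintegral_infinitePi_eval ν i (measurable_gmcoPt_right O M N hs x i)
      (fun ω ω' h => gmcoPt_congr O M N x fun j hj => h j hj.ne) hG
    rw [← lintegral_indicator_one hm1]
    refine (le_of_eq h1).trans ?_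
    have h2 : ∀ ζ, ∫⁻ s, {p : Vec n × S | bad p.1 (innerOut h O M N x p.1 p.2)}.indicator
          (fun _ => (1 : ENNReal)) (ζ, s) ∂ν ≤ ENNReal.ofReal (2 * q / (L * θ)) := by
      intro ζ
      have h3 : MeasurableSet {s | bad ζ (innerOut h O M N x ζ s)} :=
        (measurable_prodMk_left (x := ζ)) hset
      refine (le_of_eq ?_).trans (measure_not_accurateStep_le hs hMf hL hLh hq hq0 hu hθ0 hθ ζ)
      rw [← lintegral_indicator_one h3]
      rfl
    calc _ ≤ ∫⁻ _, ENNReal.ofReal (2 * q / (L * θ)) ∂P := lintegral_mono fun s => h2 _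
      _ = _ := by simp [P]
  calc _ ≤ P (⋃ i ∈ Finset.range (2 * k),
        {s | bad (gmcoPt h O M N x s i) (gmcoPt h O M N x s (i + 1))}) := by
        refine measure_mono fun s hs' => ?_
        by_contra hcon
        simp only [Set.mem_iUnion, Finset.mem_range, Set.mem_ofPred_eq, hbad, not_exists,
          not_not] at hcon
        obtain ⟨j, hj1, hj2, hj3⟩ := exists_small_grad (hs.reg_bounds L x) hs.kern_bounds hL
          (by linarith) (by linarith) hu hθ0.le hθ' hk0 hk (gmcoPt h O M N x s) hcon
        exact hs' j hj1 hj2 (gmcoStop_of_small_grad hs hMf hL hu hj3)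
    _ ≤ ∑ i ∈ Finset.range (2 * k),
        P {s | bad (gmcoPt h O M N x s i) (gmcoPt h O M N x s (i + 1))} :=
        measure_biUnion_finset_le _ _
    _ ≤ ∑ i ∈ Finset.range (2 * k), ENNReal.ofReal (2 * q / (L * θ)) :=
        Finset.sum_le_sum fun i _ => hstep i
    _ = _ := by
        rw [Finset.sum_const, Finset.card_range, nsmul_eq_mul, ← ENNReal.ofReal_natCast,
          ← ENNReal.ofReal_mul (by positivity)]
        push_cast; rfl

end CompositeGradientRun

/-! ### The stopping time and its expected excess -/

section StoppingTime

variable {n : ℕ} {h g : Vec n → ℝ} {κ : ℕ} {Q A S : Type*} [MeasurableSpace S]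
  {ν : Measure S} {c C τ L Lh Mf : ℝ}

/-- The starting points and seeds for which none of the first `k` iterates passes the stopping
test. -/
def noStopSet (h : Vec n → ℝ) (O : BasicOracle g κ Q A)
    (M : InnerMethod g O.answer ν (L + Lh) c C τ) (N k : ℕ) : Set (Vec n × (ℕ → S)) :=
  {p | ∀ j, 1 ≤ j → j ≤ k → ¬ gmcoStop h O L p.1 (gmcoPt h O M N p.1 p.2 j)}

/-- The number of iterations beyond the first `k₀` that do not yet pass the stopping test. -/
noncomputable def gmcoExcess (h : Vec n → ℝ) (O : BasicOracle g κ Q A)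
    (M : InnerMethod g O.answer ν (L + Lh) c C τ) (N k₀ : ℕ) (p : Vec n × (ℕ → S)) : ENNReal :=
  ∑' k, (noStopSet h O M N (k₀ + k)).indicator 1 p

variable (h) (O : BasicOracle g κ Q A) (M : InnerMethod g O.answer ν (L + Lh) c C τ) (N : ℕ)

/-- The second alternative makes the stopping index a total, measurable `Nat.find`, with value 0 on
runs that never stop. -/
lemma exists_stop_or_never (p : Vec n × (ℕ → S)) :
    ∃ k, (1 ≤ k ∧ gmcoStop h O L p.1 (gmcoPt h O M N p.1 p.2 k)) ∨
      ∀ j, 1 ≤ j → ¬ gmcoStop h O L p.1 (gmcoPt h O M N p.1 p.2 j) := by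
  by_cases H : ∃ k, 1 ≤ k ∧ gmcoStop h O L p.1 (gmcoPt h O M N p.1 p.2 k)
  · exact ⟨H.choose, Or.inl H.choose_spec⟩
  · push Not at H
    exact ⟨0, Or.inr H⟩

open Classical in
/-- The number of iterations of the composite gradient method, `0` if it does not terminate. -/
noncomputable def gmcoLen (p : Vec n × (ℕ → S)) : ℕ := Nat.find (exists_stop_or_never h O M N p)

/-- The output of the composite gradient method, the starting point if it does not terminate. -/
noncomputable def gmcoOut (p : Vec n × (ℕ → S)) : Vec n :=
  gmcoPt h O M N p.1 p.2 (gmcoLen h O M N p)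

variable {h}

lemma measurableSet_noStopSet (hs : SmoothSplit h g Mf Lh) (k : ℕ) :
    MeasurableSet (noStopSet h O M N k) := by
  have : noStopSet h O M N k = ⋂ j ∈ Set.Icc 1 k,
      {p : Vec n × (ℕ → S) | gmcoStop h O L p.1 (gmcoPt h O M N p.1 p.2 j)}ᶜ := by
    ext p
    simp [noStopSet]
  rw [this]
  exact MeasurableSet.biInter (Set.to_countable _)
    fun j _ => (measurableSet_gmcoStop O M N hs j).compl

lemma measurable_gmcoExcess (hs : SmoothSplit h g Mf Lh) (k₀ : ℕ) :
    Measurable (gmcoExcess h O M N k₀) := by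
  unfold gmcoExcess
  exact Measurable.tsum fun k =>
    measurable_one.indicator (measurableSet_noStopSet O M N hs _)

lemma measurable_gmcoOut (hs : SmoothSplit h g Mf Lh) : Measurable (gmcoOut h O M N) := by
  classical
  refine Measurable.find (f := fun k (p : Vec n × (ℕ → S)) => gmcoPt h O M N p.1 p.2 k)
    (fun k => measurable_gmcoPt O M N hs k) (fun k => ?_) (exists_stop_or_never h O M N)
  refine MeasurableSet.union ?_ ?_
  · exact (MeasurableSet.const _).inter (measurableSet_gmcoStop O M N hs k)
  · have : {p : Vec n × (ℕ → S) |
        ∀ j, 1 ≤ j → ¬ gmcoStop h O L p.1 (gmcoPt h O M N p.1 p.2 j)} =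
        ⋂ j ∈ Set.Ici 1, {p : Vec n × (ℕ → S) | gmcoStop h O L p.1 (gmcoPt h O M N p.1 p.2 j)}ᶜ := by
      ext p
      simp
    have h2 := MeasurableSet.biInter (Set.to_countable (Set.Ici 1))
      fun j _ => (measurableSet_gmcoStop O M N hs j).compl
    rw [← this] at h2
    exact h2

variable {O M N}

/-- For a run that never stops every term of the excess is 1 and the sum is `⊤`. Otherwise the terms
with k₀ + k below the stopping index equal 1. -/
lemma gmco_of_excess_ne_top {k₀ : ℕ} {x : Vec n} {s : ℕ → S}
    (he : gmcoExcess h O M N k₀ (x, s) ≠ ⊤) :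
    gmco h O M N x s = some (gmcoIter h O M N x s (gmcoLen h O M N (x, s))) ∧
    gmcoStop h O L x (gmcoOut h O M N (x, s)) ∧
    (gmcoLen h O M N (x, s) : ENNReal) ≤ k₀ + gmcoExcess h O M N k₀ (x, s) := by
  classical
  have H : ∃ k, 1 ≤ k ∧ gmcoStop h O L x (gmcoPt h O M N x s k) := by
    by_contra! H
    refine he ?_
    have : ∀ k, (noStopSet h O M N (k₀ + k)).indicator (1 : Vec n × (ℕ → S) → ENNReal) (x, s) = 1 := fun k =>
      Set.indicator_of_mem (show (x, s) ∈ noStopSet h O M N (k₀ + k) from fun j hj _ => H j hj) _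
    simp only [gmcoExcess, this]
    exact ENNReal.tsum_const_eq_top_of_ne_zero one_ne_zero
  have hlen : gmcoLen h O M N (x, s) = Nat.find H := by
    refine Nat.find_congr' fun {k} => ?_
    constructor
    · rintro (h1 | h1)
      · exact h1
      · obtain ⟨j, hj1, hj2⟩ := H
        exact absurd hj2 (h1 j hj1)
    · exact Or.inl
  refine ⟨?_, ?_, ?_⟩
  · rw [hlen]
    exact dif_pos H
  · rw [gmcoOut, hlen]
    exact (Nat.find_spec H).2
  · rw [hlen]
    rcases le_total (Nat.find H) k₀ with h1 | h1
    · exact (Nat.cast_le.2 h1).trans le_self_add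
    · have h2 : ∑ k ∈ Finset.range (Nat.find H - k₀),
          (noStopSet h O M N (k₀ + k)).indicator (1 : Vec n × (ℕ → S) → ENNReal) (x, s) ≤
          gmcoExcess h O M N k₀ (x, s) := ENNReal.sum_le_tsum _
      have h3 : ∑ k ∈ Finset.range (Nat.find H - k₀),
          (noStopSet h O M N (k₀ + k)).indicator (1 : Vec n × (ℕ → S) → ENNReal) (x, s) =
          ∑ k ∈ Finset.range (Nat.find H - k₀), 1 := by
        refine Finset.sum_congr rfl fun k hk => ?_
        rw [Finset.mem_range] at hk
        refine Set.indicator_of_mem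
          (show (x, s) ∈ noStopSet h O M N (k₀ + k) from fun j hj hj' hst => ?_) _
        exact Nat.find_min H (m := j) (by omega) ⟨hj, hst⟩
      rw [h3] at h2
      simp only [Finset.sum_const, Finset.card_range, nsmul_eq_mul, mul_one] at h2
      calc (Nat.find H : ENNReal) = ((k₀ + (Nat.find H - k₀) : ℕ) : ENNReal) := by
            congr 1; omega
        _ ≤ _ := by push_cast; gcongr; exact_mod_cast h2

lemma gmcoIter_calls (x : Vec n) (s : ℕ → S) (k : ℕ) :
    (gmcoIter h O M N x s k).callsH = 2 * k ∧ (gmcoIter h O M N x s k).callsG ≤ N * k ∧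
      (gmcoIter h O M N x s k).testsG ≤ κ * k := by
  induction k with
  | zero => simp [gmcoIter]
  | succ k ih =>
    obtain ⟨h1, h2, h3⟩ := ih
    simp only [gmcoIter]
    refine ⟨by omega, ?_, ?_⟩
    · rw [mul_add, mul_one]
      exact add_le_add h2 (M.calls_le _ _ _ _)
    · rw [mul_add, mul_one]
      exact add_le_add h3 (O.grad_calls _)

variable [IsProbabilityMeasure ν] {q : ℝ} {x : Vec n}

/-- Each tail probability is at most ρ and at most B rⁱ. The first is small but not summable, the
second summable but not small; their geometric mean is both. -/
lemma lintegral_gmcoExcess_le (hs : SmoothSplit h g Mf Lh) (hMf : 0 ≤ Mf) (hL : 0 < L)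
    (hLh : 0 < Lh) (hq : RelAccurate h O M N q) (hq0 : 0 ≤ q) {r : ℝ} (hr0 : 0 ≤ r) (hr1 : r < 1)
    (hr : 1 - L / (L + 2 * Lh) + 2 * q / L ≤ r)
    {θ : ℝ} (hθ0 : 0 < θ) (hθ : θ ≤ L / (L + 2 * Lh))
    (hθ' : θ * ((Mf + L) * (4 * (Mf + L + 2 * Lh) * (1 + 2 * Lh / L) + 4 * (2 * Lh))) ≤ L ^ 2 / 18)
    {k : ℕ} (hk0 : 0 < k) (hk : 6 * (2 * Lh) ≤ k * L) :
    ∫⁻ s, gmcoExcess h O M N (2 * k) (x, s) ∂(Measure.infinitePi fun _ : ℕ => ν) ≤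
      ENNReal.ofReal (Real.sqrt (2 * k * (2 * q / (L * θ)) * (9 * (Mf + L) ^ 2 / L ^ 2)) /
        (1 - Real.sqrt r)) := by
  have hM : 0 < Mf + L := by linarith
  obtain ⟨u, hu⟩ := (hs.reg_bounds L x).exists_min hL (hs.continuous_reg L x)
  set ρ := 2 * k * (2 * q / (L * θ)) with hρ
  set B := 9 * (Mf + L) ^ 2 / L ^ 2 with hB
  have hρ0 : 0 ≤ ρ := by positivity
  have hB0 : 0 ≤ B := by positivity
  have hterm : ∀ i, (Measure.infinitePi fun _ : ℕ => ν)
      {s | (x, s) ∈ noStopSet h O M N (2 * k + i)} ≤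
      ENNReal.ofReal (Real.sqrt (ρ * B) * Real.sqrt r ^ i) := by
    intro i
    have hsub : {s | (x, s) ∈ noStopSet h O M N (2 * k + i)} ⊆
        {s | ∀ j, 1 ≤ j → j ≤ 2 * k → ¬ gmcoStop h O L x (gmcoPt h O M N x s j)} :=
      fun s hs' j hj1 hj2 => hs' j hj1 (hj2.trans (Nat.le_add_right _ _))
    have h1 : (Measure.infinitePi fun _ : ℕ => ν) {s | (x, s) ∈ noStopSet h O M N (2 * k + i)} ≤
        ENNReal.ofReal ρ :=
      (measure_mono hsub).trans (measure_no_stop_le hs hMf hL hLh hq hq0 hu hθ0 hθ hθ' hk0 hk)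
    have h2 : (Measure.infinitePi fun _ : ℕ => ν) {s | (x, s) ∈ noStopSet h O M N (2 * k + i)} ≤
        ENNReal.ofReal (B * r ^ i) := by
      refine ((measure_mono fun s hs' => ?_).trans
        (measure_not_stop_le_geometric hs hMf hL hLh hq hq0 hu hr0 hr (2 * k + i))).trans
        (ENNReal.ofReal_le_ofReal ?_)
      · exact hs' (2 * k + i) (by omega) le_rfl
      · exact mul_le_mul_of_nonneg_left
          (pow_le_pow_of_le_one hr0 hr1.le (Nat.le_add_left _ _)) hB0
    refine (le_min h1 h2).trans ?_
    rw [← ENNReal.ofReal_min]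
    refine ENNReal.ofReal_le_ofReal ?_
    refine (abs_le_of_sq_le_sq' ?_ (by positivity)).2
    rw [mul_pow, Real.sq_sqrt (by positivity), ← pow_mul, mul_comm i, pow_mul, Real.sq_sqrt hr0,
      sq, mul_assoc]
    exact mul_le_mul (min_le_left _ _) (min_le_right _ _) (le_min hρ0 (by positivity)) hρ0
  have hsr : Real.sqrt r < 1 := by rw [Real.sqrt_lt' one_pos]; simpa using hr1
  have hmeas : ∀ i, MeasurableSet {s : ℕ → S | (x, s) ∈ noStopSet h O M N (2 * k + i)} := fun i =>
    (measurable_prodMk_left (x := x)) (measurableSet_noStopSet O M N hs (2 * k + i))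
  calc _ = ∑' i, (Measure.infinitePi fun _ : ℕ => ν)
        {s | (x, s) ∈ noStopSet h O M N (2 * k + i)} := by
        simp only [gmcoExcess]
        have hind : ∀ i, Measurable fun s : ℕ → S => (noStopSet h O M N (2 * k + i)).indicator
            (1 : Vec n × (ℕ → S) → ENNReal) (x, s) := fun i =>
          (measurable_one.indicator
            (measurableSet_noStopSet O M N hs (2 * k + i))).comp measurable_prodMk_left
        rw [lintegral_tsum fun i => (hind i).aemeasurable]
        refine tsum_congr fun i => ?_
        rw [← lintegral_indicator_one (hmeas i)]
        rfl
    _ ≤ ∑' i, ENNReal.ofReal (Real.sqrt (ρ * B) * Real.sqrt r ^ i) := ENNReal.tsum_le_tsum hterm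
    _ = ENNReal.ofReal (∑' i, Real.sqrt (ρ * B) * Real.sqrt r ^ i) :=
        (ENNReal.ofReal_tsum_of_nonneg (fun i => by positivity)
          ((summable_geometric_of_lt_one (Real.sqrt_nonneg r) hsr).mul_left _)).symm
    _ = _ := by
        rw [tsum_mul_left, tsum_geometric_of_lt_one (Real.sqrt_nonneg r) hsr, div_eq_mul_inv]

/-- Half the number of iterations in which a run of the composite gradient method typically
terminates. -/
noncomputable def halfLen (L Lh : ℝ) : ℕ := ⌈12 * Lh / L⌉₊

end StoppingTime

/-- `q₁` is fixed before the dimension, the functions and the method. The square of δ compensates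
the square root in the expected excess. -/
lemma exists_accuracy {L Lh Mf : ℝ} (hL : 0 < L) (hLh : 0 < Lh) (hMf : 0 ≤ Mf) :
    ∃ q₁ : ℝ, 0 < q₁ ∧ ∀ (n : ℕ) (h g : Vec n → ℝ), SmoothSplit h g Mf Lh →
    ∀ (κ : ℕ) (Q A S : Type*) [MeasurableSpace S] (ν : Measure S) [IsProbabilityMeasure ν]
      (c C τ : ℝ) (O : BasicOracle g κ Q A) (M : InnerMethod g O.answer ν (L + Lh) c C τ)
      (N : ℕ) (q δ : ℝ), RelAccurate h O M N q → 0 ≤ q → 0 < δ → δ < 1 → q ≤ q₁ * δ ^ 2 →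
      ∀ x : Vec n, ∫⁻ s, gmcoExcess h O M N (2 * halfLen L Lh) (x, s)
        ∂(Measure.infinitePi fun _ : ℕ => ν) ≤ ENNReal.ofReal δ := by
  have hM : 0 < Mf + L := by linarith
  set l := L / (L + 2 * Lh) with hl
  have hl0 : 0 < l := by positivity
  have hl1 : l < 1 := by rw [hl, div_lt_one (by positivity)]; linarith
  set W := (Mf + L) * (4 * (Mf + L + 2 * Lh) * (1 + 2 * Lh / L) + 4 * (2 * Lh)) with hW
  have hW0 : 0 < W := by positivity
  set θ := min l (L ^ 2 / 18 / W) with hθ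
  have hθ0 : 0 < θ := by positivity
  have hθW : θ * W ≤ L ^ 2 / 18 := by
    rw [← le_div_iff₀ hW0]; exact min_le_right _ _
  have hk0 : 0 < halfLen L Lh := Nat.ceil_pos.2 (by positivity)
  have hk : 6 * (2 * Lh) ≤ halfLen L Lh * L := by
    have := Nat.le_ceil (12 * Lh / L)
    rw [div_le_iff₀ hL] at this
    unfold halfLen; linarith
  -- Half of the exact contraction l is given up to the inner error 2q/L.
  set r := 1 - l / 2 with hr
  have hr0 : 0 ≤ r := by linarith
  have hr1 : r < 1 := by linarith
  have hsr : Real.sqrt r < 1 := by rw [Real.sqrt_lt' one_pos]; simpa using hr1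
  have hkc : (0 : ℝ) < halfLen L Lh := by exact_mod_cast hk0
  set Z := 2 * halfLen L Lh * (2 / (L * θ)) * (9 * (Mf + L) ^ 2 / L ^ 2) with hZ
  have hZ0 : 0 < Z := by positivity
  have hsr' : 0 < 1 - Real.sqrt r := by linarith
  refine ⟨min (L * l / 4) ((1 - Real.sqrt r) ^ 2 / Z), by positivity, ?_⟩
  intro n h g hs κ Q A S _ ν _ c C τ O M N q δ hq hq0 hδ0 hδ1 hqδ x
  have hδsq : δ ^ 2 ≤ 1 := pow_le_one₀ hδ0.le hδ1.le
  have h1 : q ≤ L * l / 4 := by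
    have : min (L * l / 4) ((1 - Real.sqrt r) ^ 2 / Z) * δ ^ 2 ≤ L * l / 4 * 1 := by
      gcongr
      exact min_le_left _ _
    linarith
  have h2 : Z * q ≤ ((1 - Real.sqrt r) * δ) ^ 2 := by
    have : q ≤ (1 - Real.sqrt r) ^ 2 / Z * δ ^ 2 := hqδ.trans (by gcongr; exact min_le_right _ _)
    calc Z * q ≤ Z * ((1 - Real.sqrt r) ^ 2 / Z * δ ^ 2) := by gcongr
      _ = _ := by field_simp
  have h3 : 1 - l + 2 * q / L ≤ r := by
    have : 2 * q / L ≤ l / 2 := by rw [div_le_iff₀ hL]; linarith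
    rw [hr]; linarith
  refine (lintegral_gmcoExcess_le hs hMf hL hLh hq hq0 hr0 hr1 h3 hθ0 (min_le_left _ _) hθW hk0
    hk).trans (ENNReal.ofReal_le_ofReal ?_)
  rw [div_le_iff₀ hsr', mul_comm δ]
  refine Real.sqrt_le_iff.2 ⟨by positivity, le_trans (le_of_eq ?_) h2⟩
  rw [hZ]; ring

/-! ### The outer loop and its restarts -/

section OuterLoop

variable {n : ℕ} {h g : Vec n → ℝ} {κ : ℕ} {Q A S : Type*} [MeasurableSpace S]
  {ν : Measure S} {c C τ L Lh Mf : ℝ}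

/-- The query point of the Monteiro-Svaiter method in iteration `k`, from the state `(y, z)`. -/
noncomputable def msQuery {n : ℕ} (L : ℝ) (k : ℕ) (p : Vec n × Vec n) : Vec n :=
  (msWeight L k / msWeight L (k + 1)) • p.1 +
    (msStep L (msWeight L k) / msWeight L (k + 1)) • p.2

/-- The points `(y, z)` of the Monteiro-Svaiter method, with total middle loops. -/
noncomputable def msPt (h : Vec n → ℝ) (O : BasicOracle g κ Q A)
    (M : InnerMethod g O.answer ν (L + Lh) c C τ) (N : ℕ) (x₀ : Vec n) (s : ℕ → ℕ → S) :
    ℕ → Vec n × Vec n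
  | 0 => (x₀, x₀)
  | k + 1 =>
    let p := msPt h O M N x₀ s k
    let y := gmcoOut h O M N (msQuery L k p, s k)
    (y, p.2 - msStep L (msWeight L k) • (gradient h y + gradient g y))

/-- The points of the restarted method, with total middle loops. -/
noncomputable def restartPt (h : Vec n → ℝ) (O : BasicOracle g κ Q A)
    (M : InnerMethod g O.answer ν (L + Lh) c C τ) (N : ℕ) (x₀ : Vec n) (s : ℕ → ℕ → ℕ → S)
    (m : ℕ) : ℕ → Vec n
  | 0 => x₀
  | t + 1 => (msPt h O M N (restartPt h O M N x₀ s m t) (s t) m).1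

variable (h) (O : BasicOracle g κ Q A) (M : InnerMethod g O.answer ν (L + Lh) c C τ) (N : ℕ)

/-- The starting point and the seeds of the `k`-th call of the middle loop. -/
noncomputable def msCall (x₀ : Vec n) (s : ℕ → ℕ → S) (k : ℕ) : Vec n × (ℕ → S) :=
  (msQuery L k (msPt h O M N x₀ s k), s k)

lemma msPt_congr (x₀ : Vec n) {s s' : ℕ → ℕ → S} {k : ℕ} (hs : ∀ j < k, s j = s' j) :
    msPt h O M N x₀ s k = msPt h O M N x₀ s' k := by
  induction k with
  | zero => rfl
  | succ k ih => simp only [msPt, ih fun j hj => hs j (by omega), hs k (by omega)]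

lemma restartPt_congr (x₀ : Vec n) {s s' : ℕ → ℕ → ℕ → S} {m t : ℕ}
    (hs : ∀ j < t, ∀ k < m, s j k = s' j k) :
    restartPt h O M N x₀ s m t = restartPt h O M N x₀ s' m t := by
  induction t with
  | zero => rfl
  | succ t ih =>
    simp only [restartPt]
    rw [ih fun j hj => hs j (by omega), msPt_congr h O M N _ (hs t (by omega))]

variable {h}

lemma measurable_msPt (hs : SmoothSplit h g Mf Lh) (k : ℕ) :
    Measurable fun p : Vec n × (ℕ → ℕ → S) => msPt h O M N p.1 p.2 k := by
  induction k with
  | zero => exact measurable_fst.prodMk measurable_fst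
  | succ k ih =>
    have h1 : Measurable fun p : Vec n × (ℕ → ℕ → S) =>
        (msQuery L k (msPt h O M N p.1 p.2 k), p.2 k) := by
      unfold msQuery; fun_prop
    have h2 := (measurable_gmcoOut O M N hs).comp h1
    have h3 := hs.contGradH.measurable.comp h2
    have h4 := hs.contGradG.measurable.comp h2
    have h5 := ih.snd.sub ((h3.add h4).const_smul (msStep L (msWeight L k)))
    exact h2.prodMk h5

lemma measurable_restartPt (hs : SmoothSplit h g Mf Lh) (x₀ : Vec n) (m t : ℕ) :
    Measurable fun s : ℕ → ℕ → ℕ → S => restartPt h O M N x₀ s m t := by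
  induction t with
  | zero => exact measurable_const
  | succ t ih =>
    have h1 : Measurable fun s : ℕ → ℕ → ℕ → S => (restartPt h O M N x₀ s m t, s t) := by
      fun_prop
    have h2 := (measurable_msPt O M N hs m).comp h1
    exact h2.fst

variable {O M N}

/-- Finite excesses mean that every middle loop stops, so the `Option`-valued run agrees with the
total recursion `msPt`, on which measurability is available. Potential and call counts are carried
along. -/
lemma msIter_of_excess_ne_top (hs : SmoothSplit h g Mf Lh) (hL : 0 < L) {k₀ : ℕ} (x₀ u : Vec n)
    (s : ℕ → ℕ → S) (m : ℕ)
    (he : ∀ k < m, gmcoExcess h O M N k₀ (msCall h O M N x₀ s k) ≠ ⊤) :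
    ∃ σ, msIter h O M N x₀ s m = some σ ∧ (σ.y.point, σ.z) = msPt h O M N x₀ s m ∧
      σ.A = msWeight L m ∧
      σ.A * ((h σ.y.point + g σ.y.point) - (h u + g u)) + ‖σ.z - u‖ ^ 2 / 2 ≤
        ‖x₀ - u‖ ^ 2 / 2 ∧
      σ.y.callsH = 2 * (∑ k ∈ Finset.range m, gmcoLen h O M N (msCall h O M N x₀ s k)) + m ∧
      σ.y.callsG ≤
        N * (∑ k ∈ Finset.range m, gmcoLen h O M N (msCall h O M N x₀ s k)) + κ * m ∧
      σ.y.testsG ≤ κ * (∑ k ∈ Finset.range m, gmcoLen h O M N (msCall h O M N x₀ s k)) := by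
  induction m with
  | zero => exact ⟨_, rfl, rfl, rfl, by simp, by simp, by simp, by simp⟩
  | succ m ih =>
    obtain ⟨σ, h1, h2, h3, h4, h5, h6, h7⟩ := ih fun k hk => he k (by omega)
    have hq : msQuery L m (msPt h O M N x₀ s m) =
        (σ.A / (σ.A + msStep L σ.A)) • σ.y.point + (msStep L σ.A / (σ.A + msStep L σ.A)) • σ.z := by
      rw [← h2, h3]; rfl
    obtain ⟨g1, g2, -⟩ := gmco_of_excess_ne_top (he m (by omega))
    obtain ⟨c1, c2, c3⟩ := gmcoIter_calls (h := h) (O := O) (M := M) (N := N)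
      (msQuery L m (msPt h O M N x₀ s m)) (s m) (gmcoLen h O M N (msCall h O M N x₀ s m))
    set x := msQuery L m (msPt h O M N x₀ s m) with hx
    set r := gmcoIter h O M N x (s m) (gmcoLen h O M N (msCall h O M N x₀ s m)) with hr
    have hrp : r.point = gmcoOut h O M N (x, s m) := rfl
    have hrec : msIter h O M N x₀ s (m + 1) = some
      { y := ⟨r.point, σ.y.callsH + r.callsH + 1,
          σ.y.callsG + r.callsG + (O.grad r.point).calls O.answer, σ.y.testsG + r.testsG⟩
        z := σ.z - msStep L σ.A • (gradient h r.point + (O.grad r.point).output O.answer)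
        A := σ.A + msStep L σ.A } := by
      have g1' : gmco h O M N ((σ.A / (σ.A + msStep L σ.A)) • σ.y.point +
          (msStep L σ.A / (σ.A + msStep L σ.A)) • σ.z) (s m) = some r := by
        rw [← hq]; exact g1
      rw [msIter, h1, Option.bind_some]
      change Option.map _ (gmco h O M N ((σ.A / (σ.A + msStep L σ.A)) • σ.y.point +
          (msStep L σ.A / (σ.A + msStep L σ.A)) • σ.z) (s m)) = _
      rw [g1']
      rfl
    refine ⟨_, hrec, ?_, ?_, ?_, ?_, ?_, ?_⟩
    · simp only [O.grad_output, msPt, ← h2, h3, hrp]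
      rw [h2]
    · simp only [msWeight, h3]
    · simp only [O.grad_output]
      refine le_trans ?_ h4
      refine ms_potential_step (f := fun v => h v + g v)
        (df := fun v => gradient h v + gradient g v)
        (fun a b => by simpa using (hs.bregF a b).1) hL (h3 ▸ msWeight_nonneg hL m) u σ.y.point
        σ.z x r.point hq ?_
      have := g2
      rwa [gmcoStop_iff] at this
    · rw [Finset.sum_range_succ]
      simp only
      omega
    · rw [Finset.sum_range_succ]
      have := O.grad_calls r.point
      simp only [mul_add, mul_one] at *
      omega
    · rw [Finset.sum_range_succ]
      simp only [mul_add] at *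
      omega

lemma ms_of_excess_ne_top (hs : SmoothSplit h g Mf Lh) (hL : 0 < L) {k₀ : ℕ} (x₀ u : Vec n)
    (s : ℕ → ℕ → S) {m : ℕ} (hm : 0 < m)
    (he : ∀ k < m, gmcoExcess h O M N k₀ (msCall h O M N x₀ s k) ≠ ⊤) :
    ∃ r, ms h O M N x₀ s m = some r ∧ r.point = (msPt h O M N x₀ s m).1 ∧
      (h r.point + g r.point) - (h u + g u) ≤ 2 * L / (m : ℝ) ^ 2 * ‖x₀ - u‖ ^ 2 ∧
      r.callsH = 2 * (∑ k ∈ Finset.range m, gmcoLen h O M N (msCall h O M N x₀ s k)) + m ∧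
      r.callsG ≤
        N * (∑ k ∈ Finset.range m, gmcoLen h O M N (msCall h O M N x₀ s k)) + κ * m ∧
      r.testsG ≤ κ * (∑ k ∈ Finset.range m, gmcoLen h O M N (msCall h O M N x₀ s k)) := by
  obtain ⟨σ, h1, h2, h3, h4, h5, h6, h7⟩ := msIter_of_excess_ne_top hs hL x₀ u s m he
  refine ⟨σ.y, by rw [ms, h1]; rfl, by rw [← h2], ?_, h5, h6, h7⟩
  set Δ := (h σ.y.point + g σ.y.point) - (h u + g u) with hΔ
  have hm' : (0 : ℝ) < m := by exact_mod_cast hm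
  rcases le_or_gt Δ 0 with h0 | h0
  · exact h0.trans (by positivity)
  · have h8 := msWeight_ge hL m
    rw [← h3] at h8
    have h9 : (m : ℝ) ^ 2 / (4 * L) * Δ ≤ ‖x₀ - u‖ ^ 2 / 2 := by
      have := mul_le_mul_of_nonneg_right h8 h0.le
      have := sq_nonneg ‖σ.z - u‖
      linarith
    calc Δ = 4 * L / (m : ℝ) ^ 2 * ((m : ℝ) ^ 2 / (4 * L) * Δ) := by field_simp
      _ ≤ 4 * L / (m : ℝ) ^ 2 * (‖x₀ - u‖ ^ 2 / 2) := by gcongr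
      _ = _ := by ring

variable (h O M N) in
/-- The starting point and the seeds of the call of the middle loop in iteration `k` of restart
`t`. -/
noncomputable def restartCall (x₀ : Vec n) (s : ℕ → ℕ → ℕ → S) (m t k : ℕ) : Vec n × (ℕ → S) :=
  msCall h O M N (restartPt h O M N x₀ s m t) (s t) k

lemma msRestart_of_excess_ne_top (hs : SmoothSplit h g Mf Lh) (hL : 0 < L) {k₀ : ℕ} (x₀ u : Vec n)
    (s : ℕ → ℕ → ℕ → S) {m : ℕ} (hm : 0 < m) (T : ℕ)
    (he : ∀ t < T, ∀ k < m, gmcoExcess h O M N k₀ (restartCall h O M N x₀ s m t k) ≠ ⊤) :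
    (∃ r, msRestart h O M N x₀ s m T = some r ∧ r.point = restartPt h O M N x₀ s m T ∧
      r.callsH = 2 * (∑ t ∈ Finset.range T, ∑ k ∈ Finset.range m,
        gmcoLen h O M N (restartCall h O M N x₀ s m t k)) + T * m ∧
      r.callsG ≤ N * (∑ t ∈ Finset.range T, ∑ k ∈ Finset.range m,
        gmcoLen h O M N (restartCall h O M N x₀ s m t k)) + κ * (T * m) ∧
      r.testsG ≤ κ * (∑ t ∈ Finset.range T, ∑ k ∈ Finset.range m,
        gmcoLen h O M N (restartCall h O M N x₀ s m t k))) ∧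
    ∀ t < T, (h (restartPt h O M N x₀ s m (t + 1)) + g (restartPt h O M N x₀ s m (t + 1))) -
      (h u + g u) ≤ 2 * L / (m : ℝ) ^ 2 * ‖restartPt h O M N x₀ s m t - u‖ ^ 2 := by
  induction T with
  | zero => exact ⟨⟨_, rfl, rfl, by simp, by simp, by simp⟩, by simp⟩
  | succ T ih =>
    obtain ⟨⟨r, h1, h2, h3, h4, h5⟩, h6⟩ := ih fun t ht => he t (by omega)
    obtain ⟨r', g1, g2, g3, g4, g5, g6⟩ := ms_of_excess_ne_top hs hL
      (restartPt h O M N x₀ s m T) u (s T) hm (he T (by omega))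
    refine ⟨⟨⟨r'.point, r.callsH + r'.callsH, r.callsG + r'.callsG, r.testsG + r'.testsG⟩,
      ?_, g2, ?_, ?_, ?_⟩, ?_⟩
    · rw [msRestart, h1, Option.bind_some, h2, g1]
      rfl
    · rw [Finset.sum_range_succ, h3, g4]
      simp only [restartCall]
      ring
    · rw [Finset.sum_range_succ]
      refine (add_le_add h4 g5).trans (le_of_eq ?_)
      simp only [restartCall]
      ring
    · rw [Finset.sum_range_succ]
      refine (add_le_add h5 g6).trans (le_of_eq ?_)
      simp only [restartCall]
      ring
    · intro t ht
      rcases Nat.lt_succ_iff_lt_or_eq.1 ht with h7 | h7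
      · exact h6 t h7
      · subst h7
        rw [g2] at g3
        exact g3

end OuterLoop

/-! ### Total cost and final accuracy -/

section TotalCost

variable {n : ℕ} {h g : Vec n → ℝ} {κ : ℕ} {Q A S : Type*} [MeasurableSpace S]
  {ν : Measure S} {c C τ L Lh Mf δ : ℝ}
  {O : BasicOracle g κ Q A} {M : InnerMethod g O.answer ν (L + Lh) c C τ} {N : ℕ}

/-- The starting point of call (t, k) depends only on earlier seed blocks, and the bound `hE` is
uniform in the starting point. -/
lemma lintegral_restart_excess_le [IsProbabilityMeasure ν] (hs : SmoothSplit h g Mf Lh) {k₀ : ℕ}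
    (hE : ∀ x : Vec n, ∫⁻ s, gmcoExcess h O M N k₀ (x, s)
      ∂(Measure.infinitePi fun _ : ℕ => ν) ≤ ENNReal.ofReal δ)
    (x₀ : Vec n) (m t k : ℕ) :
    ∫⁻ ω, gmcoExcess h O M N k₀ (restartCall h O M N x₀ (fun t k j => ω (t, k, j)) m t k)
      ∂(Measure.infinitePi fun _ : ℕ × ℕ × ℕ => ν) ≤ ENNReal.ofReal δ := by
  have hseed : Measurable fun (ω : ℕ × ℕ × ℕ → S) (t k j : ℕ) => ω (t, k, j) := by fun_prop
  have hΦm : Measurable fun ω : ℕ × ℕ × ℕ → S => msQuery L k (msPt h O M N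
      (restartPt h O M N x₀ (fun t k j => ω (t, k, j)) m t) (fun k j => ω (t, k, j)) k) := by
    have h1 := (measurable_restartPt O M N hs x₀ m t).comp hseed
    have h2 : Measurable fun (ω : ℕ × ℕ × ℕ → S) (k j : ℕ) => ω (t, k, j) := by fun_prop
    have h3 := (measurable_msPt O M N hs k).comp (h1.prodMk h2)
    have h4 : Measurable fun p : Vec n × Vec n => msQuery L k p := by unfold msQuery; fun_prop
    exact h4.comp h3
  have hΦ : ∀ ω ω' : ℕ × ℕ × ℕ → S,
      (∀ j, j ∉ Set.range (fun j : ℕ => (t, k, j)) → ω j = ω' j) →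
      msQuery L k (msPt h O M N (restartPt h O M N x₀ (fun t k j => ω (t, k, j)) m t)
        (fun k j => ω (t, k, j)) k) =
      msQuery L k (msPt h O M N (restartPt h O M N x₀ (fun t k j => ω' (t, k, j)) m t)
        (fun k j => ω' (t, k, j)) k) := by
    intro ω ω' hω
    rw [restartPt_congr h O M N x₀ (s := fun t k j => ω (t, k, j))
      (s' := fun t k j => ω' (t, k, j)) fun t' ht' k' _ => funext fun j => hω _ ?_,
      msPt_congr h O M N _ (s := fun k j => ω (t, k, j))
      (s' := fun k j => ω' (t, k, j)) fun k' hk' => funext fun j => hω _ ?_]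
    · rintro ⟨i, hi⟩
      simp only [Prod.mk.injEq] at hi
      omega
    · rintro ⟨i, hi⟩
      simp only [Prod.mk.injEq] at hi
      omega
  have hinj : Function.Injective fun j : ℕ => (t, k, j) := fun i j hij => by simpa using hij
  have h1 := lintegral_infinitePi_block ν hinj hΦm hΦ
    (G := fun x s => gmcoExcess h O M N k₀ (x, s)) (measurable_gmcoExcess O M N hs k₀)
  refine (le_of_eq h1).trans ?_
  calc _ ≤ ∫⁻ _, ENNReal.ofReal δ ∂(Measure.infinitePi fun _ : ℕ × ℕ × ℕ => ν) :=
        lintegral_mono fun ω => hE _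
    _ = _ := by simp

lemma measurable_restart_excess (hs : SmoothSplit h g Mf Lh) (k₀ : ℕ) (x₀ : Vec n) (m t k : ℕ) :
    Measurable fun ω : ℕ × ℕ × ℕ → S =>
      gmcoExcess h O M N k₀ (restartCall h O M N x₀ (fun t k j => ω (t, k, j)) m t k) := by
  have hseed : Measurable fun (ω : ℕ × ℕ × ℕ → S) (t k j : ℕ) => ω (t, k, j) := by fun_prop
  have h1 := (measurable_restartPt O M N hs x₀ m t).comp hseed
  have h2 : Measurable fun (ω : ℕ × ℕ × ℕ → S) (k j : ℕ) => ω (t, k, j) := by fun_prop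
  have h3 := (measurable_msPt O M N hs k).comp (h1.prodMk h2)
  have h4 : Measurable fun p : Vec n × Vec n => msQuery L k p := by unfold msQuery; fun_prop
  have h5 : Measurable fun (ω : ℕ × ℕ × ℕ → S) (j : ℕ) => ω (t, k, j) := by fun_prop
  exact (measurable_gmcoExcess O M N hs k₀).comp ((h4.comp h3).prodMk h5)

lemma measure_total_excess_lt [IsProbabilityMeasure ν] (hs : SmoothSplit h g Mf Lh) {k₀ : ℕ} (hδ : 0 ≤ δ)
    (hE : ∀ x : Vec n, ∫⁻ s, gmcoExcess h O M N k₀ (x, s)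
      ∂(Measure.infinitePi fun _ : ℕ => ν) ≤ ENNReal.ofReal δ)
    (x₀ : Vec n) {m T : ℕ} (hm : 0 < m) (hT : 0 < T) :
    ENNReal.ofReal (1 - δ) ≤ Measure.infinitePi (fun _ : ℕ × ℕ × ℕ => ν)
      {ω | ∑ t ∈ Finset.range T, ∑ k ∈ Finset.range m, gmcoExcess h O M N k₀
        (restartCall h O M N x₀ (fun t k j => ω (t, k, j)) m t k) < ((T * m : ℕ) : ENNReal)} := by
  set P := Measure.infinitePi (fun _ : ℕ × ℕ × ℕ => ν) with hP
  set Z : (ℕ × ℕ × ℕ → S) → ENNReal := fun ω => ∑ t ∈ Finset.range T, ∑ k ∈ Finset.range m,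
    gmcoExcess h O M N k₀ (restartCall h O M N x₀ (fun t k j => ω (t, k, j)) m t k) with hZ
  have hZm : Measurable Z := Finset.measurable_sum _ fun t _ => Finset.measurable_sum _ fun k _ =>
    measurable_restart_excess hs k₀ x₀ m t k
  have hEZ : ∫⁻ ω, Z ω ∂P ≤ ((T * m : ℕ) : ENNReal) * ENNReal.ofReal δ := by
    simp only [hZ]
    rw [lintegral_finsetSum _ fun t _ => Finset.measurable_sum _ fun k _ =>
      measurable_restart_excess hs k₀ x₀ m t k]
    calc _ ≤ ∑ t ∈ Finset.range T, ∑ k ∈ Finset.range m, ENNReal.ofReal δ := by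
          refine Finset.sum_le_sum fun t _ => ?_
          rw [lintegral_finsetSum _ fun k _ => measurable_restart_excess hs k₀ x₀ m t k]
          exact Finset.sum_le_sum fun k _ => lintegral_restart_excess_le hs hE x₀ m t k
      _ = _ := by simp [mul_assoc]
  have hJ0 : ((T * m : ℕ) : ENNReal) ≠ 0 := by exact_mod_cast (Nat.mul_pos hT hm).ne'
  have hbad : P {ω | ((T * m : ℕ) : ENNReal) ≤ Z ω} ≤ ENNReal.ofReal δ := by
    refine (meas_ge_le_lintegral_div hZm.aemeasurable hJ0 (ENNReal.natCast_ne_top _)).trans ?_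
    refine ENNReal.div_le_of_le_mul ?_
    rwa [mul_comm] at hEZ
  have hcompl : {ω | Z ω < ((T * m : ℕ) : ENNReal)} = {ω | ((T * m : ℕ) : ENNReal) ≤ Z ω}ᶜ := by
    ext ω; simp
  rw [hcompl, prob_compl_eq_one_sub (measurableSet_le measurable_const hZm),
    ENNReal.ofReal_sub 1 hδ, ENNReal.ofReal_one]
  exact tsub_le_tsub_left hbad 1

lemma halfLen_bound (hL : 0 < L) (hLh : L ≤ Lh) :
    ((2 * halfLen L Lh + 1 : ℕ) : ℝ) ≤ 27 * (Lh / L) := by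
  have h1 : (halfLen L Lh : ℝ) < 12 * Lh / L + 1 := by
    have : 0 < Lh := by linarith
    exact Nat.ceil_lt_add_one (by positivity)
  have h2 : 1 ≤ Lh / L := by rwa [one_le_div hL]
  push_cast
  rw [mul_div_assoc] at h1
  linarith

/-- Serves both cases of the theorem through `hgap`. On the good event the T·m middle loops take at
most 27 (Lh/L) iterations on average; 648 = 12·54 and 324 = 12·27. -/
lemma measure_restart_succeeds [IsProbabilityMeasure ν] (hs : SmoothSplit h g Mf Lh) (hL : 0 < L) (hLh : L ≤ Lh)
    (hδ : 0 ≤ δ)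
    (hE : ∀ x : Vec n, ∫⁻ s, gmcoExcess h O M N (2 * halfLen L Lh) (x, s)
      ∂(Measure.infinitePi fun _ : ℕ => ν) ≤ ENNReal.ofReal δ)
    (x₀ xmin : Vec n) {m T : ℕ} (hm : 0 < m) (hT : 0 < T) {K inner ε : ℝ} (hc : 0 < c)
    (hN : (N : ℝ) ≤ (2 * c + 1) * inner) (hJ : (T : ℝ) * m ≤ 12 * K)
    (hgap : ∀ p : ℕ → Vec n, p 0 = x₀ → (∀ t < T, (h (p (t + 1)) + g (p (t + 1))) -
      (h xmin + g xmin) ≤ 2 * L / (m : ℝ) ^ 2 * ‖p t - xmin‖ ^ 2) →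
      (h (p T) + g (p T)) - (h xmin + g xmin) ≤ ε) :
    ENNReal.ofReal (1 - δ) ≤ Measure.infinitePi (fun _ : ℕ × ℕ × ℕ => ν)
      {ω | Succeeds (fun x => h x + g x) xmin ε
        (648 * (K * (1 + Lh / L)))
        (324 * (2 * c + 1) * (K * (κ + Lh / L * inner)))
        (324 * (2 * c + 1) * (K * (κ * (1 + Lh / L) + Lh / L * inner)))
        (msRestart h O M N x₀ (fun t k j => ω (t, k, j)) m T)} := by
  refine (measure_total_excess_lt hs hδ hE x₀ hm hT).trans (measure_mono fun ω hω => ?_)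
  set s : ℕ → ℕ → ℕ → S := fun t k j => ω (t, k, j) with hsω
  rw [Set.mem_ofPred_eq] at hω
  have hfin : ∀ t < T, ∀ k < m,
      gmcoExcess h O M N (2 * halfLen L Lh) (restartCall h O M N x₀ s m t k) ≠ ⊤ := by
    intro t ht k hk htop
    refine (hω.trans (ENNReal.natCast_lt_top _)).ne ?_
    rw [ENNReal.sum_eq_top]
    exact ⟨t, Finset.mem_range.2 ht, ENNReal.sum_eq_top.2 ⟨k, Finset.mem_range.2 hk, htop⟩⟩
  obtain ⟨⟨r, h1, h2, h3, h4, h5⟩, h6⟩ := msRestart_of_excess_ne_top hs hL x₀ xmin s hm T hfin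
  set tot := ∑ t ∈ Finset.range T, ∑ k ∈ Finset.range m,
    gmcoLen h O M N (restartCall h O M N x₀ s m t k) with htot
  have hlen : tot ≤ T * m * (2 * halfLen L Lh + 1) := by
    have h7 : (tot : ENNReal) ≤ ((T * m * (2 * halfLen L Lh + 1) : ℕ) : ENNReal) := by
      calc (tot : ENNReal) = ∑ t ∈ Finset.range T, ∑ k ∈ Finset.range m,
            (gmcoLen h O M N (restartCall h O M N x₀ s m t k) : ENNReal) := by
            rw [htot]; push_cast; rfl
        _ ≤ ∑ t ∈ Finset.range T, ∑ k ∈ Finset.range m, (((2 * halfLen L Lh : ℕ) : ENNReal) +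
            gmcoExcess h O M N (2 * halfLen L Lh) (restartCall h O M N x₀ s m t k)) := by
            refine Finset.sum_le_sum fun t ht => Finset.sum_le_sum fun k hk => ?_
            exact (gmco_of_excess_ne_top
              (hfin t (Finset.mem_range.1 ht) k (Finset.mem_range.1 hk))).2.2
        _ = ((T * m * (2 * halfLen L Lh) : ℕ) : ENNReal) + ∑ t ∈ Finset.range T,
            ∑ k ∈ Finset.range m,
            gmcoExcess h O M N (2 * halfLen L Lh) (restartCall h O M N x₀ s m t k) := by
            simp only [Finset.sum_add_distrib, Finset.sum_const, Finset.card_range, nsmul_eq_mul]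
            push_cast; ring
        _ ≤ ((T * m * (2 * halfLen L Lh) : ℕ) : ENNReal) + ((T * m : ℕ) : ENNReal) := by
            gcongr
        _ = _ := by push_cast; ring
    exact_mod_cast h7
  have hl := halfLen_bound hL hLh
  have hρ : 1 ≤ Lh / L := by rwa [one_le_div hL]
  have hJ0 : (0 : ℝ) ≤ T * m := by positivity
  have hlenR : (tot : ℝ) ≤ T * m * (27 * (Lh / L)) := by
    calc (tot : ℝ) ≤ ((T * m * (2 * halfLen L Lh + 1) : ℕ) : ℝ) := by exact_mod_cast hlen
      _ = T * m * ((2 * halfLen L Lh + 1 : ℕ) : ℝ) := by push_cast; ring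
      _ ≤ _ := by gcongr
  have hinner : 0 ≤ inner := by
    have : (0 : ℝ) ≤ N := by positivity
    by_contra! hneg
    have := mul_neg_of_pos_of_neg (by linarith : 0 < 2 * c + 1) hneg
    linarith
  have hG : (r.callsG : ℝ) ≤ T * m * (27 * (2 * c + 1) * (Lh / L * inner) + κ) := by
    calc (r.callsG : ℝ) ≤ ((N * tot + κ * (T * m) : ℕ) : ℝ) := by exact_mod_cast h4
      _ = N * (tot : ℝ) + κ * (T * m) := by push_cast; ring
      _ ≤ (2 * c + 1) * inner * (T * m * (27 * (Lh / L))) + κ * (T * m) := by gcongr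
      _ = _ := by ring
  have hTe : (r.testsG : ℝ) ≤ T * m * (27 * (Lh / L) * κ) := by
    calc (r.testsG : ℝ) ≤ ((κ * tot : ℕ) : ℝ) := by exact_mod_cast h5
      _ = κ * (tot : ℝ) := by push_cast; ring
      _ ≤ κ * (T * m * (27 * (Lh / L))) := by gcongr
      _ = _ := by ring
  have hLh0 : 0 < Lh := by linarith
  have hκ : (0 : ℝ) ≤ κ := by positivity
  have hκc : (0 : ℝ) ≤ c * κ := by positivity
  have hρi : 0 ≤ Lh / L * inner := by positivity
  have hκρ : 0 ≤ Lh / L * κ := by positivity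
  have hcκρ : 0 ≤ c * (Lh / L * κ) := by positivity
  refine ⟨r, h1, ?_, ?_, ?_, ?_⟩
  · simp only [h2]
    exact hgap (restartPt h O M N x₀ s m) rfl h6
  · rw [h3]
    push_cast
    calc 2 * (tot : ℝ) + T * m ≤ T * m * (54 * (1 + Lh / L)) := by nlinarith
      _ ≤ 12 * K * (54 * (1 + Lh / L)) := by gcongr
      _ = _ := by ring
  · calc (r.callsG : ℝ) ≤ T * m * (27 * (2 * c + 1) * (Lh / L * inner) + κ) := hG
      _ ≤ 12 * K * (27 * (2 * c + 1) * (Lh / L * inner) + 27 * (2 * c + 1) * κ) := by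
          refine mul_le_mul hJ ?_ (by positivity) (by linarith)
          linarith
      _ = _ := by ring
  · calc (r.callsG : ℝ) + r.testsG ≤
          T * m * (27 * (2 * c + 1) * (Lh / L * inner) + κ + 27 * (Lh / L) * κ) := by linarith
      _ ≤ 12 * K * (27 * (2 * c + 1) * (Lh / L * inner) +
            27 * (2 * c + 1) * (κ * (1 + Lh / L))) := by
          refine mul_le_mul hJ ?_ (by positivity) (by linarith)
          linarith
      _ = _ := by ring

lemma msRestart_one (x₀ : Vec n) (s : ℕ → ℕ → ℕ → S) (m : ℕ) :
    msRestart h O M N x₀ s m 1 = ms h O M N x₀ (s 0) m := by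
  simp only [msRestart, Option.bind_some, zero_add]
  cases ms h O M N x₀ (s 0) m <;> rfl

lemma gap_le_of_single_run {f : Vec n → ℝ} {xmin : Vec n} {R ε : ℝ} (hL : 0 < L) {m : ℕ}
    (hm : 0 < m) (hε : 0 < ε) (hmε : Real.sqrt (2 * L * R ^ 2 / ε) ≤ m) {x y : Vec n}
    (hR : ‖x - xmin‖ ≤ R)
    (hy : f y - f xmin ≤ 2 * L / (m : ℝ) ^ 2 * ‖x - xmin‖ ^ 2) : f y - f xmin ≤ ε := by
  have hm' : (0 : ℝ) < m := by exact_mod_cast hm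
  have h1 := (Real.sqrt_le_left hm'.le).1 hmε
  rw [div_le_iff₀ hε] at h1
  calc f y - f xmin ≤ 2 * L / (m : ℝ) ^ 2 * R ^ 2 := hy.trans (by gcongr)
    _ = 2 * L * R ^ 2 / (m : ℝ) ^ 2 := by ring
    _ ≤ ε := by rw [div_le_iff₀ (by positivity)]; linarith

/-- A restart of m ≥ √(8L/μ) iterations leaves a gap of at most (μ/4)‖p t - xmin‖², which by
quadratic growth halves the squared distance. -/
lemma gap_le_of_restarts {f : Vec n → ℝ} {xmin : Vec n} {R ε μ : ℝ}
    (hμ : 0 < μ) (hε : 0 < ε) {m : ℕ} (hm : 0 < m) (hmμ : Real.sqrt (8 * L / μ) ≤ m) {T : ℕ}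
    (hT : 0 < T) (hTε : μ * R ^ 2 / ε ≤ 2 ^ T)
    (hgrow : ∀ x, μ / 2 * ‖x - xmin‖ ^ 2 ≤ f x - f xmin) (p : ℕ → Vec n)
    (hR : ‖p 0 - xmin‖ ≤ R)
    (hp : ∀ t < T, f (p (t + 1)) - f xmin ≤ 2 * L / (m : ℝ) ^ 2 * ‖p t - xmin‖ ^ 2) :
    f (p T) - f xmin ≤ ε := by
  have hm' : (0 : ℝ) < m := by exact_mod_cast hm
  have h1 := (Real.sqrt_le_left hm'.le).1 hmμ
  rw [div_le_iff₀ hμ] at h1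
  have h2 : 2 * L / (m : ℝ) ^ 2 ≤ μ / 4 := by rw [div_le_iff₀ (by positivity)]; linarith
  have h3 : ∀ t < T, f (p (t + 1)) - f xmin ≤ μ / 4 * ‖p t - xmin‖ ^ 2 := fun t ht =>
    (hp t ht).trans (by gcongr)
  have h4 : ∀ t ≤ T, 2 ^ t * ‖p t - xmin‖ ^ 2 ≤ R ^ 2 := by
    intro t
    induction t with
    | zero => intro _; simpa using pow_le_pow_left₀ (norm_nonneg _) hR 2
    | succ t ih =>
      intro ht
      have h5 := (hgrow (p (t + 1))).trans (h3 t (by omega))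
      have h6 : ‖p (t + 1) - xmin‖ ^ 2 ≤ ‖p t - xmin‖ ^ 2 / 2 := by
        have : μ * ‖p (t + 1) - xmin‖ ^ 2 ≤ μ * (‖p t - xmin‖ ^ 2 / 2) := by linarith
        exact le_of_mul_le_mul_left this hμ
      calc (2 : ℝ) ^ (t + 1) * ‖p (t + 1) - xmin‖ ^ 2 ≤
            2 ^ (t + 1) * (‖p t - xmin‖ ^ 2 / 2) := by gcongr
        _ = 2 ^ t * ‖p t - xmin‖ ^ 2 := by ring
        _ ≤ R ^ 2 := ih (by omega)
  -- The first T - 1 restarts are used through the distance, the last one through the function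
  -- value.
  obtain ⟨t, rfl⟩ : ∃ t, T = t + 1 := ⟨T - 1, by omega⟩
  rw [div_le_iff₀ hε, pow_succ (2 : ℝ) t] at hTε
  have h5 := h4 t (by omega)
  have h6 := h3 t (by omega)
  have h7 : (2 : ℝ) ^ t * (f (p (t + 1)) - f xmin) ≤ 2 ^ t * ε := by
    calc (2 : ℝ) ^ t * (f (p (t + 1)) - f xmin) ≤ 2 ^ t * (μ / 4 * ‖p t - xmin‖ ^ 2) := by gcongr
      _ = μ / 4 * (2 ^ t * ‖p t - xmin‖ ^ 2) := by ring
      _ ≤ μ / 4 * R ^ 2 := by gcongr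
      _ ≤ 2 ^ t * ε := by nlinarith [pow_pos (two_pos : (0 : ℝ) < 2) t]
  exact le_of_mul_le_mul_left h7 (by positivity)

end TotalCost

end OracleSeparation

/-! ### Choice of the constants -/

open OracleSeparation in
theorem theorem1 :
    ∃ Kh : ℝ, 0 < Kh ∧ ∀ c : ℝ, 0 < c → ∃ Kinn Kg : ℝ, 0 < Kinn ∧ 0 < Kg ∧
    ∀ C Lf Lg Lh L : ℝ, 0 < C → 0 < L → L ≤ Lh → ∃ C₁ : ℝ, 0 < C₁ ∧
    ∀ (n : ℕ) (h g : Vec n → ℝ) (μ : ℝ),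
      IsSmooth (fun x => h x + g x) Lf → StrongConvexOn Set.univ μ (fun x => h x + g x) →
      IsSmooth h Lh → IsSmooth g Lg →
    ∀ (κ : ℕ) (τ : ℝ), Real.sqrt (L + Lh) < τ →
    ∀ (Q A S : Type*) [MeasurableSpace S] (ν : Measure S) [IsProbabilityMeasure ν]
      (O : BasicOracle g κ Q A) (M : InnerMethod g O.answer ν (L + Lh) c C τ)
      (x₀ xmin : Vec n) (R ε δ : ℝ),
      (∀ x, h xmin + g xmin ≤ h x + g x) → ‖x₀ - xmin‖ ≤ R → 0 < ε → 0 < δ → δ < 1 →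
      (μ = 0 → ε ≤ L * R ^ 2 →
        let inner := τ / Real.sqrt (L + Lh) * Real.log (C₁ * R / (δ * Real.sqrt ε))
        let K := Real.sqrt (L * R ^ 2 / ε)
        ENNReal.ofReal (1 - δ) ≤ Measure.infinitePi (fun _ : ℕ × ℕ × ℕ => ν)
          {ω | Succeeds (fun x => h x + g x) xmin ε
            (Kh * (K * (1 + Lh / L)))
            (Kg * (K * (κ + Lh / L * inner)))
            (Kg * (K * (κ * (1 + Lh / L) + Lh / L * inner)))
            (framework h O M ⌈Kinn * inner⌉₊ μ R ε x₀ ω)}) ∧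
      (0 < μ → μ ≤ L → 2 * ε ≤ μ * R ^ 2 →
        let inner := τ / Real.sqrt (L + Lh) * Real.log (C₁ / δ)
        let K := Real.sqrt (L / μ) * Real.log (μ * R ^ 2 / ε)
        ENNReal.ofReal (1 - δ) ≤ Measure.infinitePi (fun _ : ℕ × ℕ × ℕ => ν)
          {ω | Succeeds (fun x => h x + g x) xmin ε
            (Kh * (K * (1 + Lh / L)))
            (Kg * (K * (κ + Lh / L * inner)))
            (Kg * (K * (κ * (1 + Lh / L) + Lh / L * inner)))
            (framework h O M ⌈Kinn * inner⌉₊ μ R ε x₀ ω)}) := by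
  -- The factor 2 in `2 * c` comes from log Y² = 2 log Y; the `+ 1` in `2 * c + 1` absorbs rounding
  -- up the budget.
  refine ⟨648, by norm_num, fun c hc => ⟨2 * c, 324 * (2 * c + 1), by positivity, by positivity,
    fun C Lf Lg Lh L hC hL hLh => ?_⟩⟩
  have hLh0 : 0 < Lh := by linarith
  obtain ⟨q₁, hq₁, hacc⟩ := exists_accuracy hL hLh0 (abs_nonneg Lf)
  -- For Y ≥ D/δ, the first entry gives log Y ≥ 1 and the second gives C/Y² ≤ q₁δ².
  set D := max (Real.exp 1) (Real.sqrt (C / q₁)) with hD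
  have hD0 : 0 < D := lt_max_of_lt_left (Real.exp_pos 1)
  have hDsq : C ≤ q₁ * D ^ 2 := by
    have h1 : C / q₁ ≤ D ^ 2 := by
      rw [← Real.sq_sqrt (by positivity : 0 ≤ C / q₁)]
      gcongr
      exact le_max_right _ _
    rwa [div_le_iff₀ hq₁, mul_comm] at h1
  -- The factor √L serves the convex case, where ε ≤ LR² only gives R/√ε ≥ 1/√L.
  refine ⟨D * max 1 (Real.sqrt L), by positivity, ?_⟩
  intro n h g μ hf hconv hh hg κ τ hτ Q A S _ ν _ O M x₀ xmin R ε δ hmin hR hε hδ0 hδ1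
  have hα : 0 < Real.sqrt (L + Lh) := Real.sqrt_pos.2 (by linarith)
  have hratio : 1 < τ / Real.sqrt (L + Lh) := (one_lt_div hα).2 hτ
  have hbudget : SmoothSplit h g |Lf| Lh → ∀ Y : ℝ, D / δ ≤ Y →
      (∀ x : Vec n, ∫⁻ s, gmcoExcess h O M ⌈2 * c * (τ / Real.sqrt (L + Lh) * Real.log Y)⌉₊
        (2 * halfLen L Lh) (x, s) ∂(Measure.infinitePi fun _ : ℕ => ν) ≤ ENNReal.ofReal δ) ∧
      ((⌈2 * c * (τ / Real.sqrt (L + Lh) * Real.log Y)⌉₊ : ℕ) : ℝ) ≤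
        (2 * c + 1) * (τ / Real.sqrt (L + Lh) * Real.log Y) := by
    intro hs Y hY
    have hDY : D ≤ Y := by
      refine le_trans ?_ hY
      rw [le_div_iff₀ hδ0]
      nlinarith
    have hY0 : 0 < Y := lt_of_lt_of_le hD0 hDY
    have hlog : 1 ≤ Real.log Y := by
      rw [Real.le_log_iff_exp_le hY0]
      exact (le_max_left _ _).trans hDY
    have hinner : 1 ≤ τ / Real.sqrt (L + Lh) * Real.log Y := by nlinarith
    refine ⟨?_, ?_⟩
    · refine hacc n h g hs κ Q A S ν c C τ O M _ (C / Y ^ 2) δ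
        (relAccurate_of_budget hC hY0 ?_) (by positivity) hδ0 hδ1 ?_
      · refine le_trans (le_of_eq ?_) (Nat.le_ceil _)
        rw [Real.log_pow]
        push_cast
        ring
      · rw [div_le_iff₀ (by positivity)]
        rw [div_le_iff₀ hδ0] at hY
        calc C ≤ q₁ * D ^ 2 := hDsq
          _ ≤ q₁ * (Y * δ) ^ 2 := by gcongr
          _ = _ := by ring
    · have := Nat.ceil_lt_add_one (by positivity :
        0 ≤ 2 * c * (τ / Real.sqrt (L + Lh) * Real.log Y))
      linarith
  constructor
  · intro hμ hεR
    simp only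
    subst hμ
    have hs := smoothSplit_of_isSmooth hf (strongConvexOn_zero.1 hconv) hh hg
    have hR0 : 0 < R := by
      refine lt_of_le_of_ne ((norm_nonneg _).trans hR) fun hR0 => ?_
      rw [← hR0] at hεR
      norm_num at hεR
      linarith
    have hεs : 0 < Real.sqrt ε := Real.sqrt_pos.2 hε
    have hY : D / δ ≤ D * max 1 (Real.sqrt L) * R / (δ * Real.sqrt ε) := by
      have h1 : Real.sqrt ε ≤ Real.sqrt L * R := by
        rw [← Real.sqrt_sq hR0.le, ← Real.sqrt_mul hL.le]
        exact Real.sqrt_le_sqrt hεR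
      have h2 : Real.sqrt ε ≤ max 1 (Real.sqrt L) * R := h1.trans (by gcongr; exact le_max_right _ _)
      rw [div_le_div_iff₀ hδ0 (by positivity)]
      calc D * (δ * Real.sqrt ε) ≤ D * (δ * (max 1 (Real.sqrt L) * R)) := by gcongr
        _ = _ := by ring
    obtain ⟨hE, hN⟩ := hbudget hs _ hY
    set K := Real.sqrt (L * R ^ 2 / ε) with hK
    have hK1 : 1 ≤ K := by
      rw [hK, Real.one_le_sqrt, one_le_div hε]; exact hεR
    have hpos : 0 < Real.sqrt (2 * L * R ^ 2 / ε) := Real.sqrt_pos.2 (by positivity)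
    have hm : 0 < ⌈Real.sqrt (2 * L * R ^ 2 / ε)⌉₊ := Nat.ceil_pos.2 hpos
    have hmK : Real.sqrt (2 * L * R ^ 2 / ε) ≤ 2 * K := by
      rw [Real.sqrt_le_left (by positivity), mul_pow, hK, Real.sq_sqrt (by positivity)]
      have : 0 ≤ L * R ^ 2 / ε := by positivity
      linarith [show 2 * L * R ^ 2 / ε = 2 * (L * R ^ 2 / ε) by ring]
    have hJ : ((1 : ℕ) : ℝ) * (⌈Real.sqrt (2 * L * R ^ 2 / ε)⌉₊ : ℕ) ≤ 12 * K := by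
      have := Nat.ceil_lt_add_one hpos.le
      rw [Nat.cast_one, one_mul]
      linarith
    -- The convex case is a single restart, T = 1.
    have hmain := measure_restart_succeeds (ε := ε) hs hL hLh hδ0.le hE x₀ xmin hm one_pos hc hN hJ
      (fun p hp0 hp => gap_le_of_single_run (f := fun x => h x + g x) hL hm hε (Nat.le_ceil _)
        hR (by have := hp 0 one_pos; rwa [hp0] at this))
    simp only [msRestart_one] at hmain
    simpa only [framework, if_true] using hmain
  · intro hμ hμL hεR
    simp only
    have hs := smoothSplit_of_isSmooth hf (hconv.mono hμ.le |> strongConvexOn_zero.1) hh hg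
    have hY : D / δ ≤ D * max 1 (Real.sqrt L) / δ := by
      gcongr
      exact le_mul_of_one_le_right hD0.le (le_max_left _ _)
    obtain ⟨hE, hN⟩ := hbudget hs _ hY
    set X := μ * R ^ 2 / ε with hX
    have hX2 : 2 ≤ X := by rw [hX, le_div_iff₀ hε]; exact hεR
    have hlogb : 1 ≤ Real.logb 2 X := by
      rw [Real.le_logb_iff_rpow_le one_lt_two (by linarith)]
      simpa using hX2
    have hT : 0 < ⌈Real.logb 2 X⌉₊ := Nat.ceil_pos.2 (by linarith)
    have hpos : 0 < Real.sqrt (8 * L / μ) := Real.sqrt_pos.2 (by positivity)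
    have hm : 0 < ⌈Real.sqrt (8 * L / μ)⌉₊ := Nat.ceil_pos.2 hpos
    -- As log₂ X ≥ 1, rounding up at most doubles it, and 2/ln 2 < 3.
    have hTlog : ((⌈Real.logb 2 X⌉₊ : ℕ) : ℝ) ≤ 3 * Real.log X := by
      have h1 := Nat.ceil_lt_add_one (by linarith : 0 ≤ Real.logb 2 X)
      have h2 : Real.logb 2 X * Real.log 2 = Real.log X :=
        div_mul_cancel₀ _ (Real.log_pos one_lt_two).ne'
      have h3 := Real.log_two_gt_d9
      nlinarith
    have hmK : ((⌈Real.sqrt (8 * L / μ)⌉₊ : ℕ) : ℝ) ≤ 4 * Real.sqrt (L / μ) := by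
      have h1 := Nat.ceil_lt_add_one hpos.le
      have h2 : 1 ≤ Real.sqrt (L / μ) := by rw [Real.one_le_sqrt, one_le_div hμ]; exact hμL
      have h3 : Real.sqrt (8 * L / μ) ≤ 3 * Real.sqrt (L / μ) := by
        rw [Real.sqrt_le_left (by positivity), mul_pow, Real.sq_sqrt (by positivity)]
        have : 0 ≤ L / μ := by positivity
        linarith [show 8 * L / μ = 8 * (L / μ) by ring]
      linarith
    have hJ : ((⌈Real.logb 2 X⌉₊ : ℕ) : ℝ) * (⌈Real.sqrt (8 * L / μ)⌉₊ : ℕ) ≤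
        12 * (Real.sqrt (L / μ) * Real.log X) := by
      have h0 : 0 ≤ Real.log X := Real.log_nonneg (by linarith)
      calc _ ≤ 3 * Real.log X * (4 * Real.sqrt (L / μ)) := by gcongr
        _ = _ := by ring
    have hTX : X ≤ 2 ^ ⌈Real.logb 2 X⌉₊ := by
      have := Nat.le_ceil (Real.logb 2 X)
      rw [Real.logb_le_iff_le_rpow one_lt_two (by linarith), Real.rpow_natCast] at this
      exact this
    have hmain := measure_restart_succeeds (ε := ε) hs hL hLh hδ0.le hE x₀ xmin hm hT hc hN hJ
      (fun p hp0 hp => gap_le_of_restarts (f := fun x => h x + g x) hμ hε hm (Nat.le_ceil _) hT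
        hTX (fun x => quadratic_growth_of_strongConvexOn hconv hmin x) p (by rwa [hp0]) hp)
    simpa only [framework, if_neg hμ.ne'] using hmain
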